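/- Let $J=[0,+\infty)$, let $\mathbb{R}^n$ carry a norm $\|\cdot\|$ and let $\mathcal{L}(\mathbb{R}^n)$ be the space of real $n\times n$ matrices with the induced operator norm. Let $A\colon J\to\mathcal{L}(\mathbb{R}^n)$ be of locally bounded variation and suppose that $I-[A(t)-A(t^-)]$ is invertible for every $t>0$ and $I+[A(t^+)-A(t)]$ is invertible for every $t\ge 0$. A function $x\colon[s_0,+\infty)\to\mathbb{R}^n$, $s_0\ge 0$, is a solution of the homogeneous generalized linear differential equation (GLDE) $\frac{dx}{d\tau}=D[A(t)x]$ if $x(d)-x(c)=\int_c^d \mathrm{d}[A(s)]\,x(s)$ for all $s_0\le c\le d$. Here $\int_a^b \mathrm{d}[A(s)]f(s)$ is the Kurzweil--Stieltjes integral: it is the element $\mathcal I$ such that for every $\varepsilon>0$ there is a gauge $\delta\colon[a,b]\to(0,+\infty)$ with $\big\|\sum_{j}[A(\alpha_j)-A(\alpha_{j-1})]f(\tau_j)-\mathcal I\big\|<\varepsilon$ for every partition $a=\alpha_0<\dots<\alpha_\nu=b$ with tags $\tau_j\in[\alpha_{j-1},\alpha_j]\subset(\tau_j-\delta(\tau_j),\tau_j+\delta(\tau_j))$,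 and $\int_b^a=-\int_a^b$. Then there is exactly one function $U\colon J\times J\to\mathcal{L}(\mathbb{R}^n)$, the transition matrix of the GLDE, such that $U(t,s)=I+\int_s^t\mathrm{d}[A(r)]\,U(r,s)$ for all $t,s\in J$, and the following are equivalent. (i) The trivial solution is uniformly asymptotically stable, i.e. it is uniformly stable (for every $\varepsilon>0$ there is $\delta>0$ such that every solution $x$ on $[s_0,+\infty)$, $s_0\ge0$, with $\|x(s_0)\|<\delta$ satisfies $\|x(t)\|<\varepsilon$ for all $t\ge s_0$), and there is $\delta_0>0$ such that for every $\varepsilon>0$ there is $T\ge0$ such that every solution $x$ on $[s_0,+\infty)$, $s_0\ge0$, with $\|x(s_0)\|<\delta_0$ satisfies $\|x(t)\|<\varepsilon$ for all $t\ge s_0+T$. (ii) There are constants $\alpha,K>0$ such that $\|U(t,s)\|\le Ke^{-\alpha(t-s)}$ for all $t\ge s\ge 0$. (iii) The trivial solution is globally uniformly exponentially stable, i.e. there are constants $\alpha,K>0$ such that every solution $x$ on $[s_0,+\infty)$, $s_0\ge0$, with $x(s_0)\ne0$ satisfies $\|x(t)\|<K\|x(s_0)\|e^{-\alpha(t-s_0)}$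 for all $t\ge s_0$. -/

import Mathlib

/-- A tagged partition `a = pt 0 < pt 1 < ... < pt ν = b` of `[a, b]` with tags
`tag j ∈ [pt j, pt (j+1)]` for `j < ν`. (The values of `pt` beyond `ν`, and of `tag` from `ν` on,
play no role.) -/
structure KurzweilPartition (a b : ℝ) where
  ν : ℕ
  pt : ℕ → ℝ
  tag : ℕ → ℝ
  pt_zero : pt 0 = a
  pt_last : pt ν = b
  pt_lt : ∀ j < ν, pt j < pt (j + 1)
  tag_mem : ∀ j < ν, tag j ∈ Set.Icc (pt j) (pt (j + 1))

namespace KurzweilPartition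

/-- `δ`-fineness of a tagged partition. -/
def IsFine {a b : ℝ} (P : KurzweilPartition a b) (δ : ℝ → ℝ) : Prop :=
  ∀ j < P.ν, Set.Icc (P.pt j) (P.pt (j + 1)) ⊆
    Set.Ioo (P.tag j - δ (P.tag j)) (P.tag j + δ (P.tag j))

/-- The Riemann-type sum `∑ [G(τ_j, α_j) - G(τ_j, α_{j-1})]`. -/
def riemannSum {X : Type*} [AddCommGroup X] {a b : ℝ} (P : KurzweilPartition a b)
    (G : ℝ → ℝ → X) : X :=
  ∑ j ∈ Finset.range P.ν, (G (P.tag j) (P.pt (j + 1)) - G (P.tag j) (P.pt j))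

end KurzweilPartition

/-- For `a ≤ b`: `G` is Kurzweil integrable on `[a, b]` and its integral is `I`.
Only the values of `G` on `[a, b] × [a, b]` matter. For `a = b` this says `I = 0`. -/
def HasKurzweilIntegral {X : Type*} [NormedAddCommGroup X] (G : ℝ → ℝ → X) (a b : ℝ) (I : X) :
    Prop :=
  ∀ ε > 0, ∃ δ : ℝ → ℝ, (∀ t ∈ Set.Icc a b, 0 < δ t) ∧
    ∀ P : KurzweilPartition a b, P.IsFine δ → ‖P.riemannSum G - I‖ < ε

/-- The oriented Kurzweil integral `∫_a^b DG(τ, t)` exists and equals `I`, with the convention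
`∫_a^b = -∫_b^a` when `b < a`. -/
def HasOrientedKurzweilIntegral {X : Type*} [NormedAddCommGroup X] (G : ℝ → ℝ → X) (a b : ℝ)
    (I : X) : Prop :=
  (a ≤ b → HasKurzweilIntegral G a b I) ∧ (b < a → HasKurzweilIntegral G b a (-I))

/-- `x` is a solution on the interval `J` of the generalized ODE `dx/dτ = DF(x, t)`. -/
def IsGODESolution {E : Type*} [NormedAddCommGroup E] (F : E → ℝ → E) (J : Set ℝ) (x : ℝ → E) :
    Prop :=
  ∀ c d : ℝ, c ≤ d → Set.Icc c d ⊆ J →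
    HasKurzweilIntegral (fun τ t => F (x τ) t) c d (x d - x c)

section GLDE

variable {E : Type*} [NormedAddCommGroup E] [NormedSpace ℝ E]

/-- `x` is a solution on `J` of the homogeneous generalized linear differential equation
`dx/dτ = D[A(t)x]`. -/
def IsGLDESolution (A : ℝ → E →L[ℝ] E) (J : Set ℝ) (x : ℝ → E) : Prop :=
  IsGODESolution (fun y t => A t y) J x

/-- Condition (D): `I - Δ⁻A(t)` is invertible for all `t > 0` and `I + Δ⁺A(t)` is invertible for
all `t ≥ 0`, where `Δ⁻A(t) = A(t) - A(t⁻)` and `Δ⁺A(t) = A(t⁺) - A(t)`. -/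
def ConditionD (A : ℝ → E →L[ℝ] E) : Prop :=
  (∀ t : ℝ, 0 < t → IsUnit (1 - (A t - Function.leftLim A t))) ∧
  (∀ t : ℝ, 0 ≤ t → IsUnit (1 + (Function.rightLim A t - A t)))

/-- `U` is a transition matrix: `U(t,s) = I + ∫_s^t d[A(r)] U(r,s)` for all `t, s ≥ 0`
(only the values of `U` on `[0,∞) × [0,∞)` matter). -/
def IsTransitionMatrix (A : ℝ → E →L[ℝ] E) (U : ℝ → ℝ → E →L[ℝ] E) : Prop :=
  ∀ t s : ℝ, 0 ≤ t → 0 ≤ s →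
    HasOrientedKurzweilIntegral (fun τ r => A r * U τ s) s t (U t s - 1)

/-- Uniform stability of the trivial solution. -/
def UniformlyStable (A : ℝ → E →L[ℝ] E) : Prop :=
  ∀ ε > 0, ∃ δ > 0, ∀ s₀ : ℝ, 0 ≤ s₀ → ∀ x : ℝ → E, IsGLDESolution A (Set.Ici s₀) x →
    ‖x s₀‖ < δ → ∀ t, s₀ ≤ t → ‖x t‖ < ε

/-- Uniform asymptotic stability of the trivial solution. -/
def UniformlyAsymptoticallyStable (A : ℝ → E →L[ℝ] E) : Prop :=
  UniformlyStable A ∧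
  ∃ δ₀ > 0, ∀ ε > 0, ∃ T : ℝ, 0 ≤ T ∧ ∀ s₀ : ℝ, 0 ≤ s₀ →
    ∀ x : ℝ → E, IsGLDESolution A (Set.Ici s₀) x →
      ‖x s₀‖ < δ₀ → ∀ t, s₀ + T ≤ t → ‖x t‖ < ε

/-- Global uniform exponential stability of the trivial solution. The strict inequality is
required for nonzero initial values only (it cannot hold for the zero solution itself). -/
def GloballyUniformlyExponentiallyStable (A : ℝ → E →L[ℝ] E) : Prop :=
  ∃ α > 0, ∃ K > 0, ∀ s₀ : ℝ, 0 ≤ s₀ → ∀ x : ℝ → E, IsGLDESolution A (Set.Ici s₀) x →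
    x s₀ ≠ 0 → ∀ t, s₀ ≤ t → ‖x t‖ < K * ‖x s₀‖ * Real.exp (-α * (t - s₀))

end GLDE

/-! Invertibility of both one-sided jumps makes the equation well posed in both time directions. A
function that satisfies it up to a small error `ε` obeys a two-point Gronwall bound
`‖x t‖ + ε ≤ K (‖x s‖ + ε)`: near each point the bound holds because `A` varies little on either
side of that point and the jumps there can be undone, and a connectedness argument makes it global.
Approximate solutions glue from local pieces that only follow the jumps, and the Gronwall bound
makes them converge uniformly to an exact solution. Compactness is never used in the state space, so
everything holds in a Banach space, and the transition matrix is itself a solution of the same kind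
of equation in the space of operators.

For the stability statement, uniform stability bounds `‖U t s‖`, attractivity gives
`‖U (s + T) s‖ ≤ 1 / 2` for one fixed `T`, and iterating `U t s = U t (s + T) * U (s + T) s` turns
this into exponential decay.
-/

open Set Filter Topology

theorem relation_of_local {α : Type*} [ConditionallyCompleteLinearOrder α] [TopologicalSpace α]
    [OrderTopology α] [DenselyOrdered α] {a b : α} (hab : a ≤ b) {R : α → α → Prop}
    (hrefl : ∀ t, R t t) (htrans : ∀ u v w, u ≤ v → v ≤ w → R u v → R v w → R u w)
    (hleft : ∀ t ∈ Ioc a b, ∀ᶠ u in 𝓝[<] t, R u t)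
    (hright : ∀ t ∈ Ico a b, ∀ᶠ v in 𝓝[>] t, R t v) : R a b := by
  set S : Set α := {t | t ∈ Icc a b ∧ R a t}
  have ha : a ∈ S := ⟨left_mem_Icc.2 hab, hrefl a⟩
  have hbdd : BddAbove S := ⟨b, fun t ht => ht.1.2⟩
  obtain ⟨c, hc⟩ : ∃ c, IsLUB S c := ⟨_, isLUB_csSup ⟨a, ha⟩ hbdd⟩
  have hac : a ≤ c := hc.1 ha
  have hcb : c ≤ b := hc.2 fun t ht => ht.1.2
  have hRc : R a c := by
    rcases hac.eq_or_lt with rfl | hac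
    · exact hrefl a
    obtain ⟨l, hl, hlc⟩ := (mem_nhdsLT_iff_exists_Ioo_subset' hac).1 (hleft c ⟨hac, hcb⟩)
    obtain ⟨u, hu, hlu, huc⟩ := hc.exists_between hl
    rcases huc.eq_or_lt with rfl | huc
    · exact hu.2
    · exact htrans a u c hu.1.1 huc.le hu.2 (hlc ⟨hlu, huc⟩)
  rcases hcb.eq_or_lt with rfl | hcb
  · exact hRc
  have : (𝓝[>] c).NeBot := nhdsGT_neBot_of_exists_gt ⟨b, hcb⟩
  obtain ⟨v, hRv, hcv, hvb⟩ := ((hright c ⟨hac, hcb⟩).and (Ioo_mem_nhdsGT hcb)).exists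
  exact absurd (hc.1 ⟨⟨hac.trans hcv.le, hvb.le⟩, htrans a c v hac hcv.le hRc hRv⟩) hcv.not_ge

namespace KurzweilPartition

variable {X : Type*} [AddCommGroup X] {a b c : ℝ} {δ δ' : ℝ → ℝ}

/-- The empty partition of the degenerate interval `[a, a]`. -/
def trivial (a : ℝ) : KurzweilPartition a a where
  ν := 0
  pt _ := a
  tag _ := a
  pt_zero := rfl
  pt_last := rfl
  pt_lt := by simp
  tag_mem := by simp

/-- The partition of `[a, b]` into a single interval, tagged by `τ`. -/
def single {τ : ℝ} (hab : a < b) (hτ : τ ∈ Icc a b) : KurzweilPartition a b where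
  ν := 1
  pt j := if j = 0 then a else b
  tag _ := τ
  pt_zero := rfl
  pt_last := rfl
  pt_lt := by simpa
  tag_mem := by simpa

/-- The concatenation of a partition of `[a, b]` with one of `[b, c]`. -/
def append (P : KurzweilPartition a b) (Q : KurzweilPartition b c) : KurzweilPartition a c where
  ν := P.ν + Q.ν
  pt j := if j ≤ P.ν then P.pt j else Q.pt (j - P.ν)
  tag j := if j < P.ν then P.tag j else Q.tag (j - P.ν)
  pt_zero := by simp [P.pt_zero]
  pt_last := by grind [P.pt_last, Q.pt_zero, Q.pt_last]
  pt_lt j hj := by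
    rcases lt_or_ge j P.ν with h | h
    · simpa [h.le, Nat.succ_le_iff.2 h] using P.pt_lt j h
    · have := Q.pt_lt (j - P.ν) (by omega)
      grind [P.pt_last, Q.pt_zero]
  tag_mem j hj := by
    rcases lt_or_ge j P.ν with h | h
    · simpa [h, h.le, Nat.succ_le_iff.2 h] using P.tag_mem j h
    · have := Q.tag_mem (j - P.ν) (by omega)
      grind [P.pt_last, Q.pt_zero]

/-- The image of a partition under `t ↦ -t`, its points listed in increasing order again. -/
def reflect (P : KurzweilPartition a b) : KurzweilPartition (-b) (-a) where
  ν := P.ν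
  pt j := -P.pt (P.ν - j)
  tag j := -P.tag (P.ν - 1 - j)
  pt_zero := by simp [P.pt_last]
  pt_last := by simp [P.pt_zero]
  pt_lt j hj := by
    have := P.pt_lt (P.ν - (j + 1)) (by omega)
    rw [show P.ν - (j + 1) + 1 = P.ν - j by omega] at this
    exact neg_lt_neg this
  tag_mem j hj := by
    have := P.tag_mem (P.ν - 1 - j) (by omega)
    rw [show P.ν - 1 - j + 1 = P.ν - j by omega, show P.ν - 1 - j = P.ν - (j + 1) by omega] at this
    rw [show P.ν - 1 - j = P.ν - (j + 1) by omega]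
    exact ⟨neg_le_neg this.2, neg_le_neg this.1⟩

theorem pt_mono (P : KurzweilPartition a b) {i j : ℕ} (hij : i ≤ j) (hj : j ≤ P.ν) :
    P.pt i ≤ P.pt j := by
  induction j, hij using Nat.le_induction with
  | base => exact le_rfl
  | succ k _ ih => exact (ih (by omega)).trans (P.pt_lt k (by omega)).le

theorem pt_mem (P : KurzweilPartition a b) {j : ℕ} (hj : j ≤ P.ν) : P.pt j ∈ Icc a b :=
  ⟨by simpa [P.pt_zero] using P.pt_mono (Nat.zero_le j) hj,
    by simpa [P.pt_last] using P.pt_mono hj le_rfl⟩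

theorem tag_mem_Icc (P : KurzweilPartition a b) {j : ℕ} (hj : j < P.ν) : P.tag j ∈ Icc a b :=
  ⟨(P.pt_mem hj.le).1.trans (P.tag_mem j hj).1, (P.tag_mem j hj).2.trans (P.pt_mem hj).2⟩

theorem sum_sub (P : KurzweilPartition a b) (F : ℝ → X) :
    ∑ j ∈ Finset.range P.ν, (F (P.pt (j + 1)) - F (P.pt j)) = F b - F a := by
  rw [Finset.sum_range_sub (fun j => F (P.pt j)), P.pt_last, P.pt_zero]

theorem norm_riemannSum_le {X : Type*} [NormedAddCommGroup X] {G : ℝ → ℝ → X} {W : ℝ → ℝ}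
    (P : KurzweilPartition a b) (hG : ∀ j < P.ν, ‖G (P.tag j) (P.pt (j + 1)) - G (P.tag j) (P.pt j)‖
      ≤ W (P.pt (j + 1)) - W (P.pt j)) : ‖P.riemannSum G‖ ≤ W b - W a := by
  rw [← P.sum_sub W]
  exact norm_sum_le_of_le _ fun j hj => hG j (Finset.mem_range.1 hj)

theorem riemannSum_self (P : KurzweilPartition a a) (G : ℝ → ℝ → X) : P.riemannSum G = 0 := by
  have hν : P.ν = 0 := by
    by_contra h
    have := P.pt_lt 0 (Nat.pos_of_ne_zero h)
    exact absurd (P.pt_mem (j := 1) (by omega)).2 (by simpa [P.pt_zero] using this)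
  simp [riemannSum, hν]

theorem riemannSum_single (hab : a < b) {τ : ℝ} (hτ : τ ∈ Icc a b) (G : ℝ → ℝ → X) :
    (single hab hτ).riemannSum G = G τ b - G τ a := by
  simp [riemannSum, single]

theorem riemannSum_append (P : KurzweilPartition a b) (Q : KurzweilPartition b c)
    (G : ℝ → ℝ → X) : (P.append Q).riemannSum G = P.riemannSum G + Q.riemannSum G := by
  simp only [riemannSum, append, Finset.sum_range_add]
  congr 1 <;> refine Finset.sum_congr rfl fun j hj => ?_ <;>
    grind [P.pt_last, Q.pt_zero]

theorem riemannSum_reflect (P : KurzweilPartition a b) (G : ℝ → ℝ → X) :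
    P.reflect.riemannSum G = -P.riemannSum fun τ t => G (-τ) (-t) := by
  rw [riemannSum, riemannSum, ← Finset.sum_range_reflect, ← Finset.sum_neg_distrib]
  refine Finset.sum_congr rfl fun j hj => ?_
  have hj : j < P.ν := Finset.mem_range.1 hj
  simp only [reflect, neg_sub]
  rw [show P.ν - 1 - (P.ν - 1 - j) = j by omega, show P.ν - (P.ν - 1 - j) = j + 1 by omega,
    show P.ν - (P.ν - 1 - j + 1) = j by omega]

theorem riemannSum_sub (P : KurzweilPartition a b) (G G' : ℝ → ℝ → X) :
    P.riemannSum (fun τ t => G τ t - G' τ t) = P.riemannSum G - P.riemannSum G' := by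
  rw [riemannSum, riemannSum, riemannSum, ← Finset.sum_sub_distrib]
  exact Finset.sum_congr rfl fun j _ => sub_sub_sub_comm _ _ _ _

theorem riemannSum_congr (P : KurzweilPartition a b) {G G' : ℝ → ℝ → X}
    (hG : ∀ τ ∈ Icc a b, ∀ t ∈ Icc a b, G τ t = G' τ t) : P.riemannSum G = P.riemannSum G' :=
  Finset.sum_congr rfl fun j hj => by
    have hj := Finset.mem_range.1 hj
    rw [hG _ (P.tag_mem_Icc hj) _ (P.pt_mem hj), hG _ (P.tag_mem_Icc hj) _ (P.pt_mem hj.le)]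

theorem IsFine.mono {P : KurzweilPartition a b} (hP : P.IsFine δ) (h : ∀ t, δ t ≤ δ' t) :
    P.IsFine δ' := fun j hj =>
  (hP j hj).trans (Ioo_subset_Ioo (by linarith [h (P.tag j)]) (by linarith [h (P.tag j)]))

theorem isFine_trivial : (trivial a).IsFine δ := fun _ hj => absurd hj (Nat.not_lt_zero _)

theorem isFine_single (hab : a < b) {τ : ℝ} (hτ : τ ∈ Icc a b) (ha : τ - δ τ < a)
    (hb : b < τ + δ τ) : (single hab hτ).IsFine δ := by
  intro j hj
  obtain rfl : j = 0 := Nat.lt_one_iff.1 hj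
  exact Icc_subset_Ioo ha hb

theorem IsFine.append {P : KurzweilPartition a b} {Q : KurzweilPartition b c}
    (hP : P.IsFine δ) (hQ : Q.IsFine δ) : (P.append Q).IsFine δ := by
  intro j hj
  have hν : (P.append Q).ν = P.ν + Q.ν := rfl
  rcases lt_or_ge j P.ν with h | h
  · simpa [KurzweilPartition.append, h, h.le, Nat.succ_le_iff.2 h] using hP j h
  · have htag : (P.append Q).tag j = Q.tag (j - P.ν) := if_neg h.not_gt
    have hpt : (P.append Q).pt j = Q.pt (j - P.ν) := by
      grind [KurzweilPartition.append, P.pt_last, Q.pt_zero]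
    have hpt' : (P.append Q).pt (j + 1) = Q.pt (j - P.ν + 1) := by
      grind [KurzweilPartition.append]
    rw [htag, hpt, hpt']
    exact hQ (j - P.ν) (by omega)

theorem IsFine.reflect {P : KurzweilPartition a b} (hP : P.IsFine fun t => δ (-t)) :
    P.reflect.IsFine δ := by
  intro j (hj : j < P.ν) t ht
  have := @hP (P.ν - 1 - j) (by omega) (-t)
  simp only [KurzweilPartition.reflect, mem_Icc, mem_Ioo,
    show P.ν - 1 - j + 1 = P.ν - j by omega] at ht this ⊢
  rw [show P.ν - (j + 1) = P.ν - 1 - j by omega] at ht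
  have := this ⟨by linarith, by linarith⟩
  exact ⟨by linarith, by linarith⟩

/-- Cousin's lemma. -/
theorem exists_isFine (hab : a ≤ b) (hδ : ∀ t ∈ Icc a b, 0 < δ t) :
    ∃ P : KurzweilPartition a b, P.IsFine δ := by
  refine relation_of_local hab (R := fun u v => ∃ P : KurzweilPartition u v, P.IsFine δ)
    (fun t => ⟨trivial t, isFine_trivial⟩) ?_ (fun t ht => ?_) (fun t ht => ?_)
  · rintro u v w - - ⟨P, hP⟩ ⟨Q, hQ⟩
    exact ⟨P.append Q, hP.append hQ⟩
  · have hδt := hδ t ⟨ht.1.le, ht.2⟩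
    filter_upwards [Ioo_mem_nhdsLT (sub_lt_self t hδt)] with u hu
    exact ⟨single hu.2 (right_mem_Icc.2 hu.2.le), isFine_single _ _ hu.1 (by linarith)⟩
  · have hδt := hδ t ⟨ht.1, ht.2.le⟩
    filter_upwards [Ioo_mem_nhdsGT (lt_add_of_pos_right t hδt)] with v hv
    exact ⟨single hv.1 (left_mem_Icc.2 hv.1.le), isFine_single _ _ (by linarith) hv.2⟩

end KurzweilPartition

/-- `I` is within `ε` of the Kurzweil integral of `G` over `[a, b]`, in the sense that the Riemann
sums subordinate to some gauge are within `ε` of `I`; the integral itself need not exist. -/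
def HasKurzweilIntegralUpTo {X : Type*} [NormedAddCommGroup X] (ε : ℝ) (G : ℝ → ℝ → X) (a b : ℝ)
    (I : X) : Prop :=
  ∃ δ : ℝ → ℝ, (∀ t ∈ Icc a b, 0 < δ t) ∧
    ∀ P : KurzweilPartition a b, P.IsFine δ → ‖P.riemannSum G - I‖ ≤ ε

section Integral

open KurzweilPartition

variable {X : Type*} [NormedAddCommGroup X] {G G' : ℝ → ℝ → X} {W : ℝ → ℝ} {a b c ε ε' : ℝ}
  {I I' : X}

namespace HasKurzweilIntegralUpTo

theorem mono (h : HasKurzweilIntegralUpTo ε G a b I) (hε : ε ≤ ε') :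
    HasKurzweilIntegralUpTo ε' G a b I := by
  obtain ⟨δ, hδ, hI⟩ := h
  exact ⟨δ, hδ, fun P hP => (hI P hP).trans hε⟩

theorem exists_partition (h : HasKurzweilIntegralUpTo ε G a b I) (hab : a ≤ b) {δ : ℝ → ℝ}
    (hδ : ∀ t ∈ Icc a b, 0 < δ t) :
    ∃ P : KurzweilPartition a b, P.IsFine δ ∧ ‖P.riemannSum G - I‖ ≤ ε := by
  obtain ⟨δ', hδ', hI⟩ := h
  obtain ⟨P, hP⟩ := exists_isFine hab fun t ht => lt_min (hδ t ht) (hδ' t ht)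
  exact ⟨P, hP.mono fun t => min_le_left _ _, hI P (hP.mono fun t => min_le_right _ _)⟩

theorem congr (h : HasKurzweilIntegralUpTo ε G a b I)
    (hG : ∀ τ ∈ Icc a b, ∀ t ∈ Icc a b, G τ t = G' τ t) :
    HasKurzweilIntegralUpTo ε G' a b I := by
  obtain ⟨δ, hδ, hI⟩ := h
  exact ⟨δ, hδ, fun P hP => P.riemannSum_congr hG ▸ hI P hP⟩

theorem sub (h : HasKurzweilIntegralUpTo ε G a b I) (h' : HasKurzweilIntegralUpTo ε' G' a b I') :
    HasKurzweilIntegralUpTo (ε + ε') (fun τ t => G τ t - G' τ t) a b (I - I') := by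
  obtain ⟨δ, hδ, hI⟩ := h
  obtain ⟨δ', hδ', hI'⟩ := h'
  refine ⟨fun t => min (δ t) (δ' t), fun t ht => lt_min (hδ t ht) (hδ' t ht), fun P hP => ?_⟩
  rw [P.riemannSum_sub, sub_sub_sub_comm]
  exact (norm_sub_le _ _).trans (add_le_add (hI P (hP.mono fun t => min_le_left _ _))
    (hI' P (hP.mono fun t => min_le_right _ _)))

theorem comp_neg (h : HasKurzweilIntegralUpTo ε G (-b) (-a) I) :
    HasKurzweilIntegralUpTo ε (fun τ t => G (-τ) (-t)) a b (-I) := by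
  obtain ⟨δ, hδ, hI⟩ := h
  refine ⟨fun t => δ (-t), fun t ht => hδ _ ⟨neg_le_neg ht.2, neg_le_neg ht.1⟩, fun P hP => ?_⟩
  have := hI P.reflect hP.reflect
  rwa [riemannSum_reflect, ← norm_neg, neg_sub, sub_neg_eq_add, add_comm, ← sub_neg_eq_add] at this

theorem exists_gauge_sub_right (h : HasKurzweilIntegralUpTo ε G a b I) :
    ∃ δ : ℝ → ℝ, (∀ t ∈ Icc a b, 0 < δ t) ∧
      ∀ c ∈ Icc a b, ∀ ε' I', HasKurzweilIntegralUpTo ε' G c b I' →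
        ∀ P : KurzweilPartition a c, P.IsFine δ → ‖P.riemannSum G - (I - I')‖ ≤ ε + ε' := by
  obtain ⟨δ, hδ, hI⟩ := h
  refine ⟨δ, hδ, fun c hc ε' I' h' P hP => ?_⟩
  obtain ⟨Q, hQ, hI'⟩ := h'.exists_partition hc.2 fun t ht => hδ t ⟨hc.1.trans ht.1, ht.2⟩
  calc ‖P.riemannSum G - (I - I')‖
      = ‖((P.append Q).riemannSum G - I) - (Q.riemannSum G - I')‖ := by
        rw [riemannSum_append]; congr 1; abel
    _ ≤ ε + ε' := (norm_sub_le _ _).trans (add_le_add (hI _ (hP.append hQ)) hI')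

theorem sub_right (h : HasKurzweilIntegralUpTo ε G a b I)
    (h' : HasKurzweilIntegralUpTo ε' G c b I') (hac : a ≤ c) (hcb : c ≤ b) :
    HasKurzweilIntegralUpTo (ε + ε') G a c (I - I') := by
  obtain ⟨δ, hδ, hI⟩ := h.exists_gauge_sub_right
  exact ⟨δ, fun t ht => hδ t ⟨ht.1, ht.2.trans hcb⟩, hI c ⟨hac, hcb⟩ ε' I' h'⟩

theorem eventually_nhdsGT (h : HasKurzweilIntegralUpTo ε G a b I) (hab : a < b) :
    ∀ᶠ c in 𝓝[>] a, ∀ ε' I', HasKurzweilIntegralUpTo ε' G c b I' →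
      ‖G a c - G a a - (I - I')‖ ≤ ε + ε' := by
  obtain ⟨δ, hδ, hI⟩ := h.exists_gauge_sub_right
  have hδa := hδ a (left_mem_Icc.2 hab.le)
  filter_upwards [Ioo_mem_nhdsGT hab, Ioo_mem_nhdsGT (lt_add_of_pos_right a hδa)]
    with c hc hcδ ε' I' h'
  rw [← riemannSum_single hc.1 (left_mem_Icc.2 hc.1.le)]
  exact hI c ⟨hc.1.le, hc.2.le⟩ ε' I' h' _ (isFine_single _ _ (by linarith) hcδ.2)

theorem of_norm_sub_le (h : HasKurzweilIntegralUpTo ε G a b I)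
    (hGG' : ∀ u v τ, a ≤ u → u ≤ τ → τ ≤ v → v ≤ b →
      ‖(G' τ v - G τ v) - (G' τ u - G τ u)‖ ≤ W v - W u) :
    HasKurzweilIntegralUpTo (ε + (W b - W a) + ‖I' - I‖) G' a b I' := by
  obtain ⟨δ, hδ, hI⟩ := h
  refine ⟨δ, hδ, fun P hP => ?_⟩
  have hG : ‖P.riemannSum fun τ t => G' τ t - G τ t‖ ≤ W b - W a := P.norm_riemannSum_le
    fun j hj => hGG' _ _ _ (P.pt_mem hj.le).1 (P.tag_mem j hj).1 (P.tag_mem j hj).2 (P.pt_mem hj).2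
  rw [riemannSum_sub] at hG
  calc ‖P.riemannSum G' - I'‖
      = ‖(P.riemannSum G - I) + (P.riemannSum G' - P.riemannSum G) - (I' - I)‖ := by congr 1; abel
    _ ≤ ε + (W b - W a) + ‖I' - I‖ :=
        norm_sub_le_of_le (norm_add_le_of_le (hI P hP) hG) le_rfl

theorem norm_le (h : HasKurzweilIntegralUpTo ε G a b I) (hab : a ≤ b)
    (hG : ∀ u v τ, a ≤ u → u ≤ τ → τ ≤ v → v ≤ b → ‖G τ v - G τ u‖ ≤ W v - W u) :
    ‖I‖ ≤ W b - W a + ε := by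
  obtain ⟨P, -, hP⟩ := h.exists_partition (δ := fun _ => 1) hab fun _ _ => one_pos
  have hsum : ‖P.riemannSum G‖ ≤ W b - W a := P.norm_riemannSum_le fun j hj =>
    hG _ _ _ (P.pt_mem hj.le).1 (P.tag_mem j hj).1 (P.tag_mem j hj).2 (P.pt_mem hj).2
  linarith [norm_sub_norm_le I (P.riemannSum G), norm_sub_rev I (P.riemannSum G)]

theorem of_eventually_nhdsWithin {F : ℝ → X} (hW : Monotone W)
    (h : ∀ τ ∈ Icc a b, ∀ᶠ t in 𝓝[Icc a b] τ, ‖F t - F τ - (G τ t - G τ τ)‖ ≤ |W t - W τ|) :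
    HasKurzweilIntegralUpTo (W b - W a) G a b (F b - F a) := by
  have hδ : ∀ τ ∈ Icc a b, ∃ δ > 0, ∀ t ∈ Metric.ball τ δ, t ∈ Icc a b →
      ‖F t - F τ - (G τ t - G τ τ)‖ ≤ |W t - W τ| := fun τ hτ =>
    Metric.eventually_nhds_iff_ball.1 (eventually_nhdsWithin_iff.1 (h τ hτ))
  choose! δ hδ hFG using hδ
  refine ⟨δ, hδ, fun P hP => ?_⟩
  have hsum : P.riemannSum G - (F b - F a) = P.riemannSum fun τ t => G τ t - F t := by
    rw [riemannSum_sub, ← P.sum_sub F]; rfl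
  rw [hsum]
  refine P.norm_riemannSum_le fun j hj => ?_
  have hball : Icc (P.pt j) (P.pt (j + 1)) ⊆ Metric.ball (P.tag j) (δ (P.tag j)) :=
    Real.ball_eq_Ioo _ _ ▸ hP j hj
  have hjj := (P.pt_lt j hj).le
  have hu := hFG _ (P.tag_mem_Icc hj) _ (hball (left_mem_Icc.2 hjj)) (P.pt_mem hj.le)
  have hv := hFG _ (P.tag_mem_Icc hj) _ (hball (right_mem_Icc.2 hjj)) (P.pt_mem hj)
  have hτ := P.tag_mem j hj
  rw [abs_sub_comm, abs_of_nonneg (sub_nonneg.2 (hW hτ.1))] at hu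
  rw [abs_of_nonneg (sub_nonneg.2 (hW hτ.2))] at hv
  generalize P.tag j = τ at *
  generalize P.pt j = u at *
  generalize P.pt (j + 1) = v at *
  calc ‖G τ v - F v - (G τ u - F u)‖
      = ‖(F u - F τ - (G τ u - G τ τ)) - (F v - F τ - (G τ v - G τ τ))‖ := by congr 1; abel
    _ ≤ (W τ - W u) + (W v - W τ) := norm_sub_le_of_le hu hv
    _ = W v - W u := by abel

end HasKurzweilIntegralUpTo

theorem hasKurzweilIntegral_iff_forall_upTo :
    HasKurzweilIntegral G a b I ↔ ∀ ε > 0, HasKurzweilIntegralUpTo ε G a b I := by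
  refine ⟨fun h ε hε => ?_, fun h ε hε => ?_⟩
  · obtain ⟨δ, hδ, hI⟩ := h ε hε
    exact ⟨δ, hδ, fun P hP => (hI P hP).le⟩
  · obtain ⟨δ, hδ, hI⟩ := h (ε / 2) (half_pos hε)
    exact ⟨δ, hδ, fun P hP => (hI P hP).trans_lt (half_lt_self hε)⟩

namespace HasKurzweilIntegral

theorem self_eq_zero (h : HasKurzweilIntegral G a a I) : I = 0 := by
  rw [← norm_le_zero_iff]
  refine le_of_forall_pos_le_add fun ε hε => ?_
  simpa using (hasKurzweilIntegral_iff_forall_upTo.1 h ε hε).norm_le le_rfl (W := 0)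
    fun u v τ _ _ _ _ => by
      obtain rfl : u = v := by linarith
      simp

theorem congr (h : HasKurzweilIntegral G a b I)
    (hG : ∀ τ ∈ Icc a b, ∀ t ∈ Icc a b, G τ t = G' τ t) : HasKurzweilIntegral G' a b I :=
  hasKurzweilIntegral_iff_forall_upTo.2 fun ε hε =>
    (hasKurzweilIntegral_iff_forall_upTo.1 h ε hε).congr hG

theorem comp_neg (h : HasKurzweilIntegral G (-b) (-a) I) :
    HasKurzweilIntegral (fun τ t => G (-τ) (-t)) a b (-I) :=
  hasKurzweilIntegral_iff_forall_upTo.2 fun ε hε =>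
    (hasKurzweilIntegral_iff_forall_upTo.1 h ε hε).comp_neg

theorem sub_right (h : HasKurzweilIntegral G a b I) (h' : HasKurzweilIntegral G c b I')
    (hac : a ≤ c) (hcb : c ≤ b) : HasKurzweilIntegral G a c (I - I') := by
  rw [hasKurzweilIntegral_iff_forall_upTo] at *
  intro ε hε
  simpa using (h (ε / 2) (half_pos hε)).sub_right (h' (ε / 2) (half_pos hε)) hac hcb

theorem sub_left (h : HasKurzweilIntegral G a b I) (h' : HasKurzweilIntegral G a c I')
    (hac : a ≤ c) (hcb : c ≤ b) : HasKurzweilIntegral G c b (I - I') := by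
  have hneg : HasKurzweilIntegral (fun τ t => G (-τ) (-t)) (-b) (-c) (-I - -I') :=
    (comp_neg (by simpa)).sub_right (comp_neg (by simpa)) (neg_le_neg hcb) (neg_le_neg hac)
  simpa [neg_add_eq_sub] using hneg.comp_neg

theorem map {Y : Type*} [NormedAddCommGroup Y] [NormedSpace ℝ X] [NormedSpace ℝ Y]
    (L : X →L[ℝ] Y) (h : HasKurzweilIntegral G a b I) :
    HasKurzweilIntegral (fun τ t => L (G τ t)) a b (L I) := by
  rw [hasKurzweilIntegral_iff_forall_upTo] at h
  intro ε hε
  have : 0 < ‖L‖ + 1 := by positivity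
  obtain ⟨δ, hδ, hI⟩ := h (ε / (2 * (‖L‖ + 1))) (by positivity)
  refine ⟨δ, hδ, fun P hP => ?_⟩
  have hsum : P.riemannSum (fun τ t => L (G τ t)) = L (P.riemannSum G) := by
    simp [riemannSum, map_sum]
  rw [hsum, ← map_sub]
  calc ‖L (P.riemannSum G - I)‖ ≤ (‖L‖ + 1) * (ε / (2 * (‖L‖ + 1))) :=
        L.le_of_opNorm_le_of_le (by linarith) (hI P hP)
    _ < ε := by field_simp; linarith

end HasKurzweilIntegral

theorem hasKurzweilIntegral_self : HasKurzweilIntegral G a a 0 := fun ε hε =>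
  ⟨fun _ => 1, fun _ _ => one_pos, fun P _ => by simpa [riemannSum_self]⟩

end Integral

theorem eventually_forall_Ioc_of_nhdsGT {p : ℝ → Prop} {t : ℝ} (h : ∀ᶠ w in 𝓝[>] t, p w) :
    ∀ᶠ v in 𝓝[>] t, ∀ w ∈ Ioc t v, p w := by
  obtain ⟨c, htc, hc⟩ := mem_nhdsGT_iff_exists_Ioo_subset.1 h
  filter_upwards [Ioo_mem_nhdsGT htc] with v hv w hw using hc ⟨hw.1, hw.2.trans_lt hv.2⟩

theorem forall_le_two_mul_of_forall_le_add_half {ι : Type*} {S : Set ι} {g : ι → ℝ} {C : ℝ}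
    (hbdd : ∃ N, ∀ t ∈ S, g t ≤ N)
    (h : ∀ N, (∀ t ∈ S, g t ≤ N) → ∀ t ∈ S, g t ≤ C + N / 2) : ∀ t ∈ S, g t ≤ 2 * C := by
  intro t ht
  obtain ⟨N, hN⟩ := hbdd
  have hsup : IsLUB (g '' S) (sSup (g '' S)) :=
    isLUB_csSup ⟨g t, mem_image_of_mem g ht⟩ ⟨N, forall_mem_image.2 hN⟩
  have hle := h _ fun s hs => hsup.1 (mem_image_of_mem g hs)
  have := hsup.2 (forall_mem_image.2 hle)
  linarith [hsup.1 (mem_image_of_mem g ht)]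

section Approximation

variable {E : Type*} [NormedAddCommGroup E] [NormedSpace ℝ E] {A : ℝ → E →L[ℝ] E} {W : ℝ → ℝ}
  {x y : ℝ → E} {a b a' b' t ε ε' K L N : ℝ}

/-- The coefficient `A` is controlled by the strictly increasing function `W`, and both one-sided
jumps of the equation `dx/dτ = D[A(t)x]` are invertible at every time. -/
structure IsRegularCoefficient (A : ℝ → E →L[ℝ] E) (W : ℝ → ℝ) : Prop where
  strictMono : StrictMono W
  norm_sub_le : ∀ {u v : ℝ}, u ≤ v → ‖A v - A u‖ ≤ W v - W u
  right : ∀ t, ∃ B, Tendsto A (𝓝[>] t) (𝓝 B) ∧ IsUnit (1 + (B - A t))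
  left : ∀ t, ∃ B, Tendsto A (𝓝[<] t) (𝓝 B) ∧ IsUnit (1 + (B - A t))

namespace IsRegularCoefficient

theorem comp_neg (hA : IsRegularCoefficient A W) :
    IsRegularCoefficient (fun t => A (-t)) (fun t => -W (-t)) where
  strictMono _ _ h := neg_lt_neg (hA.strictMono (neg_lt_neg h))
  norm_sub_le h := by
    rw [norm_sub_rev, neg_sub_neg]
    exact hA.norm_sub_le (neg_le_neg h)
  right t := (hA.left (-t)).imp fun _ hB => ⟨hB.1.comp tendsto_neg_nhdsGT, hB.2⟩
  left t := (hA.right (-t)).imp fun _ hB => ⟨hB.1.comp tendsto_neg_nhdsLT, hB.2⟩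

theorem norm_apply_sub_le (hA : IsRegularCoefficient A W) (e : E) (u v : ℝ) :
    ‖(A v - A u) e‖ ≤ |W v - W u| * ‖e‖ := by
  refine (A v - A u).le_of_opNorm_le ?_ e
  rcases le_total u v with h | h
  · exact (hA.norm_sub_le h).trans (le_abs_self _)
  · rw [norm_sub_rev, abs_sub_comm]
    exact (hA.norm_sub_le h).trans (le_abs_self _)

theorem eventually_sub_le (hA : IsRegularCoefficient A W) (hε : 0 < ε) (t : ℝ) :
    ∀ᶠ v in 𝓝[>] t, ∀ s ∈ Ioc t v, W v - W s ≤ ε := by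
  have hW := hA.strictMono.monotone
  filter_upwards [(hW.tendsto_rightLim t).eventually_lt_const (lt_add_of_pos_right _ hε)]
    with v hv s hs
  linarith [hW.rightLim_le hs.1]

end IsRegularCoefficient

/-- `x` solves `dx/dτ = D[A(t)x]` on `[a, b]` up to an error of `ε` per unit increase of `W`. -/
def IsApproxSolution (A : ℝ → E →L[ℝ] E) (W : ℝ → ℝ) (ε a b : ℝ) (x : ℝ → E) : Prop :=
  ∀ c d, a ≤ c → c < d → d ≤ b →
    HasKurzweilIntegralUpTo (ε * (W d - W c)) (fun τ t => A t (x τ)) c d (x d - x c)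

namespace IsApproxSolution

theorem mono (hx : IsApproxSolution A W ε a b x) (ha : a ≤ a') (hb : b' ≤ b) :
    IsApproxSolution A W ε a' b' x :=
  fun c d hc hcd hd => hx c d (ha.trans hc) hcd (hd.trans hb)

theorem comp_neg (hx : IsApproxSolution A W ε a b x) :
    IsApproxSolution (fun t => A (-t)) (fun t => -W (-t)) ε (-b) (-a) fun t => x (-t) := by
  intro c d hc hcd hd
  have h := (hx (-d) (-c) (by linarith) (by linarith) (by linarith)).comp_neg
  rwa [neg_sub, ← neg_sub_neg (W (-d))] at h

theorem sub (hx : IsApproxSolution A W ε a b x) (hy : IsApproxSolution A W ε' a b y) :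
    IsApproxSolution A W (ε + ε') a b fun t => x t - y t := by
  intro c d hc hcd hd
  have h := (hx c d hc hcd hd).sub (hy c d hc hcd hd)
  simpa only [← add_mul, ← map_sub, sub_sub_sub_comm] using h

theorem norm_sub_le (hx : IsApproxSolution A W ε a b x) (hA : IsRegularCoefficient A W)
    (hN : ∀ s ∈ Icc a b, ‖x s‖ ≤ N) {p q : ℝ} (hp : p ∈ Icc a b) (hq : q ∈ Icc a b) :
    ‖x p - x q‖ ≤ (N + ε) * |W p - W q| := by
  wlog h : q ≤ p generalizing p q
  · rw [norm_sub_rev, abs_sub_comm]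
    exact this hq hp (le_of_not_ge h)
  rcases h.eq_or_lt with rfl | h
  · simp
  rw [abs_of_nonneg (sub_nonneg.2 (hA.strictMono.monotone h.le)), add_mul, mul_sub]
  refine (hx q p hq.1 h hp.2).norm_le h.le (W := fun t => N * W t) fun u v τ hu huτ hτv hv => ?_
  rw [← sub_apply, ← mul_sub, mul_comm]
  exact (A v - A u).le_of_opNorm_le_of_le (hA.norm_sub_le (huτ.trans hτv))
    (hN τ ⟨hq.1.trans (hu.trans huτ), (hτv.trans hv).trans hp.2⟩)

theorem eventually_norm_jump_le (hx : IsApproxSolution A W ε a b x)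
    (hA : IsRegularCoefficient A W) (hε : 0 ≤ ε) (hab : a < b) :
    ∀ᶠ w in 𝓝[>] a, ‖x w - x a - (A w - A a) (x a)‖ ≤ 2 * ε * (W b - W a) := by
  filter_upwards [(hx a b le_rfl hab le_rfl).eventually_nhdsGT hab, Ioo_mem_nhdsGT hab] with w h hw
  have hjump := h _ _ (hx w b hw.1.le hw.2 le_rfl)
  rw [sub_sub_sub_cancel_left, norm_sub_rev] at hjump
  have := mul_le_mul_of_nonneg_left (hA.strictMono hw.1).le hε
  refine hjump.trans ?_
  linarith

theorem eventually_nhdsGT_norm_le (hx : IsApproxSolution A W ε a b x)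
    (hA : IsRegularCoefficient A W) (hε : 0 ≤ ε) (hab : a < b) :
    ∀ᶠ v in 𝓝[>] a, ∃ N, ∀ s ∈ Icc a v, ‖x s‖ ≤ N := by
  have hjump := hx.eventually_norm_jump_le hA hε hab
  set C := (1 + (W b - W a)) * ‖x a‖ + 2 * ε * (W b - W a)
  filter_upwards [eventually_forall_Ioc_of_nhdsGT hjump, Ioo_mem_nhdsGT hab] with v hv hvb
  refine ⟨max ‖x a‖ C, fun s hs => ?_⟩
  rcases hs.1.eq_or_lt with rfl | has
  · exact le_max_left _ _
  refine le_max_of_le_right ?_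
  have hW := hA.strictMono.monotone
  have hs' : |W s - W a| * ‖x a‖ ≤ (W b - W a) * ‖x a‖ := by
    rw [abs_of_nonneg (sub_nonneg.2 (hW hs.1))]
    gcongr
    exact hW (hs.2.trans hvb.2.le)
  calc ‖x s‖ = ‖x a + (A s - A a) (x a) + (x s - x a - (A s - A a) (x a))‖ := by congr 1; abel
    _ ≤ ‖x a‖ + (W b - W a) * ‖x a‖ + 2 * ε * (W b - W a) :=
        norm_add_le_of_le (norm_add_le_of_le le_rfl ((hA.norm_apply_sub_le _ _ _).trans hs'))
          (hv s ⟨has, hs.2⟩)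
    _ = C := by ring

theorem exists_norm_le (hx : IsApproxSolution A W ε a b x) (hA : IsRegularCoefficient A W)
    (hε : 0 ≤ ε) (hab : a ≤ b) : ∃ N, ∀ s ∈ Icc a b, ‖x s‖ ≤ N := by
  refine relation_of_local hab (R := fun u v => ∃ N, ∀ s ∈ Icc u v, ‖x s‖ ≤ N) (fun t => ?_) ?_
    (fun t ht => ?_) (fun t ht => ?_)
  · exact ⟨‖x t‖, fun s hs => by rw [le_antisymm hs.2 hs.1]⟩
  · rintro u v w - - ⟨N, hN⟩ ⟨N', hN'⟩
    refine ⟨max N N', fun s hs => ?_⟩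
    rcases le_total s v with h | h
    · exact (hN s ⟨hs.1, h⟩).trans (le_max_left _ _)
    · exact (hN' s ⟨h, hs.2⟩).trans (le_max_right _ _)
  · have h := (hx.mono le_rfl ht.2).comp_neg.eventually_nhdsGT_norm_le hA.comp_neg hε
      (neg_lt_neg ht.1)
    filter_upwards [tendsto_neg_nhdsLT.eventually h] with u ⟨N, hN⟩
    exact ⟨N, fun s hs => by simpa using hN (-s) ⟨neg_le_neg hs.2, neg_le_neg hs.1⟩⟩
  · exact (hx.mono ht.1 le_rfl).eventually_nhdsGT_norm_le hA hε ht.2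

theorem norm_add_le_two_mul (hx : IsApproxSolution A W ε a b x) (hA : IsRegularCoefficient A W)
    (hε : 0 ≤ ε) (hW : W b - W a ≤ 1 / 2) {p q : ℝ} (hp : p ∈ Icc a b) (hq : q ∈ Icc a b) :
    ‖x p‖ + ε ≤ 2 * (‖x q‖ + ε) := by
  have hle : ∀ t ∈ Icc a b, ‖x t‖ ≤ 2 * (‖x q‖ + ε / 2) := by
    refine forall_le_two_mul_of_forall_le_add_half
      (hx.exists_norm_le hA hε (hp.1.trans hp.2)) fun N hN t ht => ?_
    have hWm := hA.strictMono.monotone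
    have hN0 : 0 ≤ N + ε := add_nonneg ((norm_nonneg _).trans (hN q hq)) hε
    have habs : |W t - W q| ≤ 1 / 2 :=
      (abs_sub_le_of_le_of_le (hWm ht.1) (hWm ht.2) (hWm hq.1) (hWm hq.2)).trans hW
    have hsub : ‖x t - x q‖ ≤ (N + ε) * (1 / 2) :=
      (hx.norm_sub_le hA hN ht hq).trans (mul_le_mul_of_nonneg_left habs hN0)
    linarith [norm_sub_norm_le (x t) (x q)]
  linarith [hle p hp]

theorem norm_right_add_le (hx : IsApproxSolution A W ε a b x) (hA : IsRegularCoefficient A W)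
    (hε : 0 ≤ ε) (hab : a < b) (hW : ∀ s ∈ Ioc a b, W b - W s ≤ 1 / 2) :
    ‖x b‖ + ε ≤ 2 * (1 + 2 * (W b - W a)) * (‖x a‖ + ε) := by
  obtain ⟨w, hjump, hw⟩ := ((hx.eventually_norm_jump_le hA hε hab).and (Ioc_mem_nhdsGT hab)).exists
  have hWm := hA.strictMono.monotone
  have hwb := (hx.mono hw.1.le le_rfl).norm_add_le_two_mul hA hε (hW w hw)
    (right_mem_Icc.2 hw.2) (left_mem_Icc.2 hw.2)
  have happ := hA.norm_apply_sub_le (x a) a w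
  rw [abs_of_nonneg (sub_nonneg.2 (hWm hw.1.le))] at happ
  have hxa : (W w - W a) * ‖x a‖ ≤ (W b - W a) * ‖x a‖ := by gcongr; exact hWm hw.2
  have hxw : ‖x w‖ ≤ ‖x a‖ + (W b - W a) * ‖x a‖ + 2 * ε * (W b - W a) := by
    rw [← add_sub_cancel (x a + (A w - A a) (x a)) (x w), ← sub_sub]
    exact norm_add_le_of_le (norm_add_le_of_le le_rfl (happ.trans hxa)) hjump
  nlinarith [mul_nonneg (sub_nonneg.2 (hWm hab.le)) (norm_nonneg (x a))]

theorem norm_jump_apply_le (hx : IsApproxSolution A W ε a b x) (hA : IsRegularCoefficient A W)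
    (hε : 0 ≤ ε) (hab : a < b) (hW : ∀ s ∈ Ioc a b, W b - W s ≤ 1 / 2) {B : E →L[ℝ] E}
    (hB : Tendsto A (𝓝[>] a) (𝓝 B)) :
    ‖(1 + (B - A a)) (x a)‖ ≤ 2 * (1 + (W b - W a)) * (‖x b‖ + ε) := by
  have hlim : Tendsto (fun w => ‖(1 + (A w - A a)) (x a)‖) (𝓝[>] a)
      (𝓝 ‖(1 + (B - A a)) (x a)‖) :=
    ((ContinuousLinearMap.apply ℝ E (x a)).continuous.norm.tendsto _).comp
      ((hB.sub_const _).const_add _)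
  refine le_of_tendsto hlim ?_
  filter_upwards [hx.eventually_norm_jump_le hA hε hab, Ioc_mem_nhdsGT hab] with w hjump hw
  have hwb := (hx.mono hw.1.le le_rfl).norm_add_le_two_mul hA hε (hW w hw)
    (left_mem_Icc.2 hw.2) (right_mem_Icc.2 hw.2)
  have heq : (1 + (A w - A a)) (x a) = x w - (x w - x a - (A w - A a) (x a)) := by
    rw [add_apply, one_apply_eq_self]
    abel
  have hD := sub_nonneg.2 (hA.strictMono.monotone hab.le)
  rw [heq]
  refine (norm_sub_le_of_le le_rfl hjump).trans ?_
  nlinarith [mul_nonneg hD (norm_nonneg (x b))]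

theorem norm_left_add_le (hx : IsApproxSolution A W ε a b x) (hA : IsRegularCoefficient A W)
    (hε : 0 ≤ ε) (hab : a < b) (hW : ∀ s ∈ Ioc a b, W b - W s ≤ 1 / 2) {B : E →L[ℝ] E}
    (hB : Tendsto A (𝓝[>] a) (𝓝 B)) {J : (E →L[ℝ] E)ˣ} (hJ : J = 1 + (B - A a)) :
    ‖x a‖ + ε ≤ (‖(↑J⁻¹ : E →L[ℝ] E)‖ * (2 * (1 + (W b - W a))) + 1) * (‖x b‖ + ε) := by
  have hinv : x a = (↑J⁻¹ : E →L[ℝ] E) ((J : E →L[ℝ] E) (x a)) := by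
    rw [← mul_apply_eq_comp, J.inv_mul, one_apply_eq_self]
  have hle : ‖x a‖ ≤ ‖(↑J⁻¹ : E →L[ℝ] E)‖ * (2 * (1 + (W b - W a)) * (‖x b‖ + ε)) := by
    rw [hinv]
    exact ContinuousLinearMap.le_opNorm_of_le _ (hJ ▸ hx.norm_jump_apply_le hA hε hab hW hB)
  linarith [norm_nonneg (x b)]

end IsApproxSolution

/-- The values of any approximate solution at two points of `[a, b]` are comparable, uniformly in
the approximation error. -/
def HasGronwallBound (A : ℝ → E →L[ℝ] E) (W : ℝ → ℝ) (a b : ℝ) : Prop :=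
  ∃ K, ∀ ε ≥ 0, ∀ x, IsApproxSolution A W ε a b x →
    ∀ p ∈ Icc a b, ∀ q ∈ Icc a b, ‖x p‖ + ε ≤ K * (‖x q‖ + ε)

namespace HasGronwallBound

theorem of_forall_le (hK : 0 ≤ K) {c : ℝ}
    (h : ∀ ε ≥ 0, ∀ x, IsApproxSolution A W ε a b x → ∀ p ∈ Icc a b,
      ‖x p‖ + ε ≤ K * (‖x c‖ + ε) ∧ ‖x c‖ + ε ≤ K * (‖x p‖ + ε)) :
    HasGronwallBound A W a b := by
  refine ⟨K * K, fun ε hε x hx p hp q hq => (h ε hε x hx p hp).1.trans ?_⟩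
  rw [mul_assoc]
  exact mul_le_mul_of_nonneg_left (h ε hε x hx q hq).2 hK

theorem refl (A : ℝ → E →L[ℝ] E) (W : ℝ → ℝ) (t : ℝ) : HasGronwallBound A W t t :=
  ⟨1, fun ε _ x _ p hp q hq => by
    rw [le_antisymm hp.2 hp.1, le_antisymm hq.2 hq.1, one_mul]⟩

theorem trans {c : ℝ} (h : HasGronwallBound A W a c) (h' : HasGronwallBound A W c b)
    (hac : a ≤ c) (hcb : c ≤ b) : HasGronwallBound A W a b := by
  obtain ⟨K, hK⟩ := h
  obtain ⟨K', hK'⟩ := h'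
  refine of_forall_le (K := max 0 (max K K')) (c := c) (le_max_left _ _) fun ε hε x hx p hp => ?_
  have hmax : ∀ {k}, k ≤ max K K' → ∀ s, k * (‖x s‖ + ε) ≤ max 0 (max K K') * (‖x s‖ + ε) :=
    fun hk s => mul_le_mul_of_nonneg_right (hk.trans (le_max_right _ _)) (by positivity)
  rcases le_total p c with h | h
  · have hle := hK ε hε x (hx.mono le_rfl hcb)
    exact ⟨(hle p ⟨hp.1, h⟩ c ⟨hac, le_rfl⟩).trans (hmax (le_max_left _ _) _),
      (hle c ⟨hac, le_rfl⟩ p ⟨hp.1, h⟩).trans (hmax (le_max_left _ _) _)⟩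
  · have hle := hK' ε hε x (hx.mono hac le_rfl)
    exact ⟨(hle p ⟨h, hp.2⟩ c ⟨le_rfl, hcb⟩).trans (hmax (le_max_right _ _) _),
      (hle c ⟨le_rfl, hcb⟩ p ⟨h, hp.2⟩).trans (hmax (le_max_right _ _) _)⟩

theorem exists_pos (h : HasGronwallBound A W a b) :
    ∃ K > 0, ∀ ε ≥ 0, ∀ x, IsApproxSolution A W ε a b x →
      ∀ p ∈ Icc a b, ∀ q ∈ Icc a b, ‖x p‖ ≤ K * (‖x q‖ + ε) := by
  obtain ⟨K, hK⟩ := h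
  refine ⟨max K 1, one_pos.trans_le (le_max_right _ _), fun ε hε x hx p hp q hq => ?_⟩
  have := mul_le_mul_of_nonneg_right (le_max_left K 1) (add_nonneg (norm_nonneg (x q)) hε)
  linarith [hK ε hε x hx p hp q hq]

theorem of_comp_neg
    (h : HasGronwallBound (fun t => A (-t)) (fun t => -W (-t)) (-b) (-a)) :
    HasGronwallBound A W a b := by
  obtain ⟨K, hK⟩ := h
  refine ⟨K, fun ε hε x hx p hp q hq => ?_⟩
  simpa using hK ε hε _ hx.comp_neg (-p) ⟨neg_le_neg hp.2, neg_le_neg hp.1⟩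
    (-q) ⟨neg_le_neg hq.2, neg_le_neg hq.1⟩

end HasGronwallBound

namespace IsRegularCoefficient

theorem eventually_hasGronwallBound (hA : IsRegularCoefficient A W) (t : ℝ) :
    ∀ᶠ v in 𝓝[>] t, HasGronwallBound A W t v := by
  obtain ⟨B, hB, J, hJ⟩ := hA.right t
  filter_upwards [hA.eventually_sub_le one_half_pos t, self_mem_nhdsWithin] with v hW htv
  set K₁ := 2 * (1 + 2 * (W v - W t))
  set K₂ := ‖(↑J⁻¹ : E →L[ℝ] E)‖ * (2 * (1 + (W v - W t))) + 1
  refine HasGronwallBound.of_forall_le (K := max 2 (max K₁ K₂)) (c := v)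
    (two_pos.le.trans (le_max_left _ _)) fun ε hε x hx p hp => ?_
  have hmax : ∀ {k}, k ≤ max 2 (max K₁ K₂) → ∀ s,
      k * (‖x s‖ + ε) ≤ max 2 (max K₁ K₂) * (‖x s‖ + ε) :=
    fun hk s => mul_le_mul_of_nonneg_right hk (by positivity)
  rcases hp.1.eq_or_lt with rfl | htp
  · exact ⟨(hx.norm_left_add_le hA hε htv hW hB hJ).trans
        (hmax ((le_max_right _ _).trans (le_max_right _ _)) _),
      (hx.norm_right_add_le hA hε htv hW).trans
        (hmax ((le_max_left _ _).trans (le_max_right _ _)) _)⟩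
  · have hle : ∀ q ∈ Icc p v, ∀ r ∈ Icc p v, ‖x q‖ + ε ≤ 2 * (‖x r‖ + ε) := fun q hq r hr =>
      (hx.mono htp.le le_rfl).norm_add_le_two_mul hA hε (hW p ⟨htp, hp.2⟩) hq hr
    have hpv := left_mem_Icc.2 hp.2
    have hvp := right_mem_Icc.2 hp.2
    exact ⟨(hle p hpv v hvp).trans (hmax (le_max_left _ _) _),
      (hle v hvp p hpv).trans (hmax (le_max_left _ _) _)⟩

theorem hasGronwallBound (hA : IsRegularCoefficient A W) (hab : a ≤ b) :
    HasGronwallBound A W a b := by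
  refine relation_of_local hab (HasGronwallBound.refl A W) (fun u v w huv hvw h h' =>
    h.trans h' huv hvw) (fun t _ => ?_) fun t _ => hA.eventually_hasGronwallBound t
  filter_upwards [tendsto_neg_nhdsLT.eventually (hA.comp_neg.eventually_hasGronwallBound (-t))]
    with u hu using hu.of_comp_neg

end IsRegularCoefficient

/-- `x` satisfies the equation `dx/dτ = D[A(t)x]` on `[a, b]` locally at every point, with a
relative error of `ε` per unit variation of `W`. Such functions can be written down explicitly near
each point, unlike exact solutions. -/
def IsLocalApproxSolution (A : ℝ → E →L[ℝ] E) (W : ℝ → ℝ) (ε a b : ℝ) (x : ℝ → E) : Prop :=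
  ∀ τ ∈ Icc a b, ∀ᶠ t in 𝓝[Icc a b] τ,
    ‖x t - x τ - (A t - A τ) (x τ)‖ ≤ ε * ‖x τ‖ * |W t - W τ|

namespace IsLocalApproxSolution

theorem comp_neg (hx : IsLocalApproxSolution A W ε (-b) (-a) x) :
    IsLocalApproxSolution (fun t => A (-t)) (fun t => -W (-t)) ε a b fun t => x (-t) := by
  intro τ hτ
  have hmaps : MapsTo (fun t : ℝ => -t) (Icc a b) (Icc (-b) (-a)) :=
    fun t ht => ⟨neg_le_neg ht.2, neg_le_neg ht.1⟩
  filter_upwards [(continuous_neg.continuousWithinAt.tendsto_nhdsWithin hmaps).eventually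
    (hx (-τ) (hmaps hτ))] with t ht
  rwa [neg_sub_neg, abs_sub_comm]

theorem congr (hx : IsLocalApproxSolution A W ε a b x) (hxy : EqOn x y (Icc a b)) :
    IsLocalApproxSolution A W ε a b y := by
  intro τ hτ
  filter_upwards [hx τ hτ, self_mem_nhdsWithin] with t ht htab
  rwa [← hxy hτ, ← hxy htab]

theorem trans {c : ℝ} (h : IsLocalApproxSolution A W ε a c x)
    (h' : IsLocalApproxSolution A W ε c b x) (hac : a ≤ c) (hcb : c ≤ b) :
    IsLocalApproxSolution A W ε a b x := by
  have hevent : ∀ {u v}, IsLocalApproxSolution A W ε u v x → ∀ τ, ∀ᶠ t in 𝓝[Icc u v] τ,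
      ‖x t - x τ - (A t - A τ) (x τ)‖ ≤ ε * ‖x τ‖ * |W t - W τ| := by
    intro u v huv τ
    by_cases hτ : τ ∈ Icc u v
    · exact huv τ hτ
    · rw [← isClosed_Icc.closure_eq, mem_closure_iff_nhdsWithin_neBot, not_neBot] at hτ
      simp [hτ]
  intro τ _
  rw [← Icc_union_Icc_eq_Icc hac hcb, nhdsWithin_union, eventually_sup]
  exact ⟨hevent h τ, hevent h' τ⟩

theorem exists_norm_le (hx : IsLocalApproxSolution A W ε a b x) (hA : IsRegularCoefficient A W)
    (hε : 0 ≤ ε) : ∃ N, ∀ s ∈ Icc a b, ‖x s‖ ≤ N := by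
  refine isCompact_Icc.induction_on (p := fun S => ∃ N, ∀ s ∈ S, ‖x s‖ ≤ N) (by simp)
    (fun S T hST ⟨N, hN⟩ => ⟨N, fun s hs => hN s (hST hs)⟩) ?_ fun τ hτ => ?_
  · rintro S T ⟨N, hN⟩ ⟨N', hN'⟩
    exact ⟨max N N', fun s hs => hs.elim (fun h => le_max_of_le_left (hN s h))
      fun h => le_max_of_le_right (hN' s h)⟩
  · refine ⟨_, Filter.inter_mem (hx τ hτ) self_mem_nhdsWithin,
      ‖x τ‖ + (W b - W a) * ‖x τ‖ + ε * ‖x τ‖ * (W b - W a), fun s ⟨hs, hsab⟩ => ?_⟩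
    have hWm := hA.strictMono.monotone
    have hW : |W s - W τ| ≤ W b - W a :=
      abs_sub_le_of_le_of_le (hWm hsab.1) (hWm hsab.2) (hWm hτ.1) (hWm hτ.2)
    rw [← add_sub_cancel (x τ + (A s - A τ) (x τ)) (x s), ← sub_sub]
    refine norm_add_le_of_le (norm_add_le_of_le le_rfl ((hA.norm_apply_sub_le _ _ _).trans ?_))
      (hs.out.trans ?_) <;> gcongr

theorem isApproxSolution (hx : IsLocalApproxSolution A W ε a b x) (hA : IsRegularCoefficient A W)
    (hε : 0 ≤ ε) (hN : ∀ s ∈ Icc a b, ‖x s‖ ≤ N) : IsApproxSolution A W (ε * N) a b x := by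
  intro c d hc hcd hd
  have hcdab : Icc c d ⊆ Icc a b := Icc_subset_Icc hc hd
  have hN0 : 0 ≤ N := (norm_nonneg _).trans (hN c ⟨hc, hcd.le.trans hd⟩)
  rw [mul_sub]
  refine HasKurzweilIntegralUpTo.of_eventually_nhdsWithin (W := fun t => ε * N * W t)
    (hA.strictMono.monotone.const_mul (mul_nonneg hε hN0)) fun τ hτ => ?_
  filter_upwards [nhdsWithin_mono τ hcdab (hx τ (hcdab hτ))] with t ht
  rw [← mul_sub, abs_mul, abs_of_nonneg (mul_nonneg hε hN0), ← sub_apply]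
  refine ht.trans ?_
  gcongr
  exact hN τ (hcdab hτ)

end IsLocalApproxSolution

/-- The explicit local approximate solution to the right of `t`, with value `ξ` at `t`: it takes
the jump prescribed by the right limit `B` of `A` at `t` and then one Euler step. -/
noncomputable def jumpStep (A : ℝ → E →L[ℝ] E) (B : E →L[ℝ] E) (t : ℝ) (ξ : E) (w : ℝ) : E :=
  if w ≤ t then ξ else (1 + (A w - B)) ((1 + (B - A t)) ξ)

namespace IsRegularCoefficient

theorem norm_rightLimit_sub_le (hA : IsRegularCoefficient A W) {B : E →L[ℝ] E}
    (hB : Tendsto A (𝓝[>] t) (𝓝 B)) {w : ℝ} (hw : t < w) : ‖B - A t‖ ≤ W w - W t := by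
  refine le_of_tendsto (hB.sub_const _).norm ?_
  filter_upwards [Ioc_mem_nhdsGT hw] with s hs
  exact (hA.norm_sub_le hs.1.le).trans (sub_le_sub_right (hA.strictMono.monotone hs.2) _)

theorem isLocalApproxSolution_jumpStep (hA : IsRegularCoefficient A W) {B : E →L[ℝ] E}
    (hB : Tendsto A (𝓝[>] t) (𝓝 B)) {v : ℝ}
    (hv : ∀ w ∈ Ioc t v, ‖A w - B‖ ≤ 1 / 2 ∧ ‖A w - B‖ ≤ ε / 2) (ξ : E) :
    IsLocalApproxSolution A W ε t v (jumpStep A B t ξ) := by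
  intro τ hτ
  set η := (1 + (B - A t)) ξ
  have hgt : ∀ {w}, t < w → jumpStep A B t ξ w = (1 + (A w - B)) η := fun h => if_neg h.not_ge
  rcases hτ.1.eq_or_lt with rfl | htτ
  · filter_upwards [self_mem_nhdsWithin] with w hw
    rw [show jumpStep A B t ξ t = ξ from if_pos le_rfl]
    rcases hw.1.eq_or_lt with rfl | htw
    · simp [jumpStep]
    have heq : (1 + (A w - B)) η - ξ - (A w - A t) ξ = (A w - B) ((B - A t) ξ) := by
      simp only [η, add_apply, sub_apply, one_apply_eq_self, map_add, map_sub]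
      abel
    have hpos : 0 ≤ ‖A w - B‖ := norm_nonneg _
    have hWtw := sub_nonneg.2 (hA.strictMono htw).le
    rw [hgt htw, heq, abs_of_nonneg hWtw, mul_assoc, mul_comm ‖ξ‖]
    exact (A w - B).le_of_opNorm_le_of_le (by linarith [(hv w ⟨htw, hw.2⟩).2])
      ((B - A t).le_of_opNorm_le (hA.norm_rightLimit_sub_le hB htw) ξ)
  · filter_upwards [mem_nhdsWithin_of_mem_nhds (Ioi_mem_nhds htτ)] with w hw
    have hη : ‖(A τ - B) η‖ ≤ ε * ‖(1 + (A τ - B)) η‖ := by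
      have hhalf := (A τ - B).le_of_opNorm_le (hv τ ⟨htτ, hτ.2⟩).1 η
      have hsmall := (A τ - B).le_of_opNorm_le (hv τ ⟨htτ, hτ.2⟩).2 η
      have htri := norm_sub_norm_le η (-((A τ - B) η))
      rw [norm_neg, sub_neg_eq_add] at htri
      have hε : 0 ≤ ε := by linarith [norm_nonneg (A τ - B), (hv τ ⟨htτ, hτ.2⟩).2]
      rw [add_apply, one_apply_eq_self]
      nlinarith
    have heq : (1 + (A w - B)) η - (1 + (A τ - B)) η - (A w - A τ) ((1 + (A τ - B)) η) =
        -(A w - A τ) ((A τ - B) η) := by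
      simp only [add_apply, sub_apply, one_apply_eq_self, map_add]
      abel
    rw [hgt hw, hgt htτ, heq, norm_neg, mul_comm]
    exact (hA.norm_apply_sub_le _ _ _).trans (mul_le_mul_of_nonneg_left hη (abs_nonneg _))

theorem eventually_exists_isLocalApproxSolution [CompleteSpace E] (hA : IsRegularCoefficient A W)
    (hε : 0 < ε) (t : ℝ) : ∀ᶠ v in 𝓝[>] t, ∀ s ∈ Icc t v, ∀ ζ : E,
      ∃ x, IsLocalApproxSolution A W ε t v x ∧ x s = ζ := by
  obtain ⟨B, hB, J, hJ⟩ := hA.right t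
  have hclose : ∀ r > 0, ∀ᶠ w in 𝓝[>] t, ‖A w - B‖ ≤ r := fun r hr => by
    simpa only [dist_eq_norm] using hB.eventually (Metric.closedBall_mem_nhds B hr)
  filter_upwards [eventually_forall_Ioc_of_nhdsGT
    ((hclose _ one_half_pos).and (hclose _ (half_pos hε)))] with v hv s hs ζ
  suffices ∃ ξ, jumpStep A B t ξ s = ζ from
    this.imp' (jumpStep A B t) fun ξ hξ => ⟨hA.isLocalApproxSolution_jumpStep hB hv ξ, hξ⟩
  rcases hs.1.eq_or_lt with rfl | hts
  · exact ⟨ζ, if_pos le_rfl⟩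
  have hunit : IsUnit (1 + (A s - B)) := by
    rw [← sub_neg_eq_add]
    refine isUnit_one_sub_of_norm_lt_one ?_
    rw [norm_neg]
    exact (hv s ⟨hts, hs.2⟩).1.trans_lt one_half_lt_one
  obtain ⟨J', hJ'⟩ := hunit
  refine ⟨(↑J⁻¹ : E →L[ℝ] E) ((↑J'⁻¹ : E →L[ℝ] E) ζ), (if_neg hts.not_ge).trans ?_⟩
  rw [← hJ, ← hJ']
  simp only [← mul_apply_eq_comp, J.mul_inv_cancel_left, J'.mul_inv, one_apply_eq_self]

theorem exists_isLocalApproxSolution [CompleteSpace E] (hA : IsRegularCoefficient A W)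
    (hε : 0 < ε) (hab : a ≤ b) : ∀ s ∈ Icc a b, ∀ ζ : E,
      ∃ x, IsLocalApproxSolution A W ε a b x ∧ x s = ζ := by
  refine relation_of_local hab (R := fun u v => ∀ s ∈ Icc u v, ∀ ζ : E,
      ∃ x, IsLocalApproxSolution A W ε u v x ∧ x s = ζ) (fun t s _ ζ => ?_) ?_ (fun t _ => ?_)
    fun t _ => hA.eventually_exists_isLocalApproxSolution hε t
  · exact ⟨fun _ => ζ, fun τ hτ => by simp [le_antisymm hτ.2 hτ.1], rfl⟩
  · intro u c v huc hcv hleft hright s hs ζ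
    have hglue : ∀ x y, IsLocalApproxSolution A W ε u c x → IsLocalApproxSolution A W ε c v y →
        x c = y c → IsLocalApproxSolution A W ε u v fun t => if t ≤ c then x t else y t := by
      intro x y hx hy hxy
      refine (hx.congr fun t ht => (if_pos ht.2).symm).trans (hy.congr fun t ht => ?_) huc hcv
      rcases ht.1.eq_or_lt with rfl | hct
      · simp [hxy]
      · exact (if_neg hct.not_ge).symm
    rcases le_or_gt s c with hsc | hcs
    · obtain ⟨x, hx, hxs⟩ := hleft s ⟨hs.1, hsc⟩ ζ
      obtain ⟨y, hy, hyc⟩ := hright c ⟨le_rfl, hcv⟩ (x c)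
      exact ⟨_, hglue x y hx hy hyc.symm, by simp [hsc, hxs]⟩
    · obtain ⟨y, hy, hys⟩ := hright s ⟨hcs.le, hs.2⟩ ζ
      obtain ⟨x, hx, hxc⟩ := hleft c ⟨huc, le_rfl⟩ (y c)
      exact ⟨_, hglue x y hx hy hxc, by simp [hcs.not_ge, hys]⟩
  · filter_upwards [tendsto_neg_nhdsLT.eventually
      (hA.comp_neg.eventually_exists_isLocalApproxSolution hε (-t))] with u hu s hs ζ
    obtain ⟨x, hx, hxs⟩ := hu (-s) ⟨neg_le_neg hs.2, neg_le_neg hs.1⟩ ζ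
    exact ⟨fun t => x (-t), by simpa using hx.comp_neg, hxs⟩

theorem exists_isApproxSolution [CompleteSpace E] (hA : IsRegularCoefficient A W) (hε : 0 < ε)
    (hab : a ≤ b) {s : ℝ} (hs : s ∈ Icc a b) (ζ : E) :
    ∃ x, IsApproxSolution A W ε a b x ∧ x s = ζ := by
  obtain ⟨K, hKpos, hK⟩ := (hA.hasGronwallBound hab).exists_pos
  set N := 2 * (K * (‖ζ‖ + ε))
  have hN : 0 < N := by positivity
  obtain ⟨x, hx, rfl⟩ := hA.exists_isLocalApproxSolution (div_pos hε hN) hab s hs ζ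
  have hεN : 0 ≤ ε / N := (div_pos hε hN).le
  have hhalf : K * (ε / N) ≤ 1 / 2 := by
    rw [← mul_div_assoc, div_le_iff₀ hN]
    linarith [mul_nonneg hKpos.le (norm_nonneg (x s))]
  have hle : ∀ t ∈ Icc a b, ‖x t‖ ≤ 2 * (K * ‖x s‖) := by
    refine forall_le_two_mul_of_forall_le_add_half (hx.exists_norm_le hA hεN) fun M hM t ht => ?_
    have hM0 : 0 ≤ M := (norm_nonneg _).trans (hM s hs)
    have hgron := hK (ε / N * M) (by positivity) x (hx.isApproxSolution hA hεN hM) t ht s hs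
    linarith [mul_le_mul_of_nonneg_right hhalf hM0]
  refine ⟨x, ?_, rfl⟩
  rw [← div_mul_cancel₀ ε hN.ne']
  refine hx.isApproxSolution hA hεN fun t ht => (hle t ht).trans ?_
  linarith [mul_pos hKpos hε]

end IsRegularCoefficient

namespace IsGLDESolution

variable {J J' : Set ℝ}

theorem mono (hx : IsGLDESolution A J x) (hJ : J' ⊆ J) : IsGLDESolution A J' x :=
  fun c d hcd h => hx c d hcd (h.trans hJ)

theorem congr {A' : ℝ → E →L[ℝ] E} (hx : IsGLDESolution A J x) (hA : EqOn A A' J)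
    (hxy : EqOn x y J) : IsGLDESolution A' J y := by
  intro c d hcd h
  rw [← hxy (h ⟨le_rfl, hcd⟩), ← hxy (h ⟨hcd, le_rfl⟩)]
  exact (hx c d hcd h).congr fun τ hτ t ht => by
    simp only [hxy (h hτ), hA (h ht)]

theorem isApproxSolution (hx : IsGLDESolution A (Icc a b) x) (hW : StrictMono W) (hε : 0 < ε) :
    IsApproxSolution A W ε a b x := fun c d hc hcd hd =>
  hasKurzweilIntegral_iff_forall_upTo.1 (hx c d hcd.le (Icc_subset_Icc hc hd)) _
    (mul_pos hε (sub_pos.2 (hW hcd)))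

theorem eqOn_of_eq (hA : IsRegularCoefficient A W) (hx : IsGLDESolution A (Icc a b) x)
    (hy : IsGLDESolution A (Icc a b) y) {s : ℝ} (hs : s ∈ Icc a b) (hxy : x s = y s) :
    EqOn x y (Icc a b) := by
  intro t ht
  obtain ⟨K, hKpos, hK⟩ := (hA.hasGronwallBound (hs.1.trans hs.2)).exists_pos
  refine eq_of_norm_sub_le_zero (le_of_forall_pos_le_add fun ε hε => ?_)
  have hεK : 0 < ε / (2 * K) := by positivity
  have hle := hK _ (by positivity) _
    ((hx.isApproxSolution hA.strictMono hεK).sub (hy.isApproxSolution hA.strictMono hεK)) t ht s hs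
  simp only [hxy, sub_self, norm_zero] at hle
  refine hle.trans_eq ?_
  field_simp
  ring

end IsGLDESolution

theorem IsApproxSolution.hasKurzweilIntegralUpTo_of_norm_sub_le
    (hx : IsApproxSolution A W ε a b x) (hA : IsRegularCoefficient A W)
    (hxy : ∀ t ∈ Icc a b, ‖y t - x t‖ ≤ L) {c d : ℝ} (hc : a ≤ c) (hcd : c < d) (hd : d ≤ b) :
    HasKurzweilIntegralUpTo (ε * (W d - W c) + L * (W d - W c + 2))
      (fun τ t => A t (y τ)) c d (y d - y c) := by
  refine ((hx c d hc hcd hd).of_norm_sub_le (W := fun t => L * W t) (I' := y d - y c)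
    fun u v τ hu huτ hτv hv => ?_).mono ?_
  · rw [← map_sub, ← map_sub, ← sub_apply, ← mul_sub, mul_comm]
    exact (A v - A u).le_of_opNorm_le_of_le (hA.norm_sub_le (huτ.trans hτv))
      (hxy τ ⟨hc.trans (hu.trans huτ), (hτv.trans hv).trans hd⟩)
  · rw [sub_sub_sub_comm]
    linarith [norm_sub_le_of_le (hxy d ⟨hc.trans hcd.le, hd⟩) (hxy c ⟨hc, hcd.le.trans hd⟩)]

namespace IsRegularCoefficient

theorem isGLDESolution_of_tendstoUniformlyOn (hA : IsRegularCoefficient A W) {ι : Type*}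
    {l : Filter ι} [l.NeBot] {ε : ι → ℝ} {z : ι → ℝ → E} (hε : Tendsto ε l (𝓝 0))
    (hz : ∀ i, IsApproxSolution A W (ε i) a b (z i)) (hx : TendstoUniformlyOn z x l (Icc a b)) :
    IsGLDESolution A (Icc a b) x := by
  intro c d hcd hsub
  rcases hcd.eq_or_lt with rfl | hcd
  · rw [sub_self]
    exact hasKurzweilIntegral_self
  have hc := (hsub ⟨le_rfl, hcd.le⟩).1
  have hd := (hsub ⟨hcd.le, le_rfl⟩).2
  refine hasKurzweilIntegral_iff_forall_upTo.2 fun η hη => ?_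
  set D := W d - W c
  have hD : 0 < D := sub_pos.2 (hA.strictMono hcd)
  set L := η / (2 * (D + 2))
  have hL : 0 < L := by positivity
  obtain ⟨i, hεi, hxi⟩ := ((hε.eventually_le_const (show 0 < η / (2 * D) by positivity)).and
    (Metric.tendstoUniformlyOn_iff.1 hx L hL)).exists
  have hle : ∀ t ∈ Icc a b, ‖x t - z i t‖ ≤ L := fun t ht => by
    rw [← dist_eq_norm]
    exact (hxi t ht).le
  refine ((hz i).hasKurzweilIntegralUpTo_of_norm_sub_le hA hle hc hcd hd).mono ?_
  calc ε i * D + L * (D + 2) ≤ η / (2 * D) * D + L * (D + 2) := by gcongr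
    _ = η := by
      simp only [L]
      field_simp
      norm_num

theorem exists_isGLDESolution_Icc [CompleteSpace E] (hA : IsRegularCoefficient A W) {s : ℝ}
    (hs : s ∈ Icc a b) (ζ : E) : ∃ x, IsGLDESolution A (Icc a b) x ∧ x s = ζ := by
  have hab := hs.1.trans hs.2
  obtain ⟨K, hKpos, hK⟩ := (hA.hasGronwallBound hab).exists_pos
  choose z hz hzs using fun n : ℕ =>
    hA.exists_isApproxSolution (Nat.one_div_pos_of_nat (α := ℝ) (n := n)) hab hs ζ
  have hdist : ∀ t ∈ Icc a b, ∀ n m : ℕ, dist (z n t) (z m t) ≤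
      K * (1 / ((n : ℝ) + 1) + 1 / ((m : ℝ) + 1)) := by
    intro t ht n m
    have := hK (1 / ((n : ℝ) + 1) + 1 / ((m : ℝ) + 1)) (by positivity) _ ((hz n).sub (hz m))
      t ht s hs
    simpa [dist_eq_norm, hzs] using this
  have hcauchy : UniformCauchySeqOn z atTop (Icc a b) := by
    refine Metric.uniformCauchySeqOn_iff.2 fun η hη => ?_
    obtain ⟨N, hN⟩ := exists_nat_one_div_lt (show 0 < η / (2 * K) by positivity)
    refine ⟨N, fun m hm n hn t ht => (hdist t ht m n).trans_lt ?_⟩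
    have hm' := Nat.one_div_le_one_div (α := ℝ) hm
    have hn' := Nat.one_div_le_one_div (α := ℝ) hn
    calc K * (1 / ((m : ℝ) + 1) + 1 / ((n : ℝ) + 1))
        ≤ K * (1 / ((N : ℝ) + 1) + 1 / ((N : ℝ) + 1)) := by gcongr
      _ < K * (η / (2 * K) + η / (2 * K)) := by gcongr
      _ = η := by field_simp; ring
  have hlim : ∀ t ∈ Icc a b, ∃ e, Tendsto (fun n => z n t) atTop (𝓝 e) := fun t ht =>
    cauchySeq_tendsto_of_complete (hcauchy.cauchySeq ht)
  choose! x hx using hlim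
  refine ⟨x, hA.isGLDESolution_of_tendstoUniformlyOn tendsto_one_div_add_atTop_nhds_zero_nat hz
    (hcauchy.tendstoUniformlyOn_of_tendsto hx), ?_⟩
  exact tendsto_nhds_unique (hx s hs) (by simp only [hzs, tendsto_const_nhds])

theorem exists_isGLDESolution [CompleteSpace E] (hA : IsRegularCoefficient A W) (s : ℝ) (ζ : E) :
    ∃ x, IsGLDESolution A univ x ∧ x s = ζ := by
  have hmem : ∀ t, s ∈ Icc (min s t) (max s t) := fun t => ⟨min_le_left _ _, le_max_left _ _⟩
  choose z hz hzs using fun t => hA.exists_isGLDESolution_Icc (hmem t) ζ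
  refine ⟨fun t => z t t, fun c d hcd _ => ?_, hzs s⟩
  have hs : s ∈ Icc (min s c) (max s d) := ⟨min_le_left _ _, le_max_left _ _⟩
  obtain ⟨y, hy, hys⟩ := hA.exists_isGLDESolution_Icc hs ζ
  have hyz : EqOn y (fun t => z t t) (Icc c d) := by
    intro t ht
    have hsub : Icc (min s t) (max s t) ⊆ Icc (min s c) (max s d) :=
      Icc_subset_Icc (min_le_min_left _ ht.1) (max_le_max_left _ ht.2)
    exact (hy.mono hsub).eqOn_of_eq hA (hz t) (hmem t) (hys.trans (hzs t).symm)
      ⟨min_le_right _ _, le_max_right _ _⟩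
  exact ((hy.mono (Icc_subset_Icc (min_le_right _ _) (le_max_right _ _))).congr
    (eqOn_refl _ _) hyz) c d hcd subset_rfl

end IsRegularCoefficient

end Approximation

section BoundedVariation

variable {X : Type*} [NormedAddCommGroup X] {f : ℝ → X}

theorem exists_tendsto_nhdsLT_of_locallyBoundedVariationOn [CompleteSpace X]
    (hf : LocallyBoundedVariationOn f univ) (t : ℝ) : ∃ l, Tendsto f (𝓝[<] t) (𝓝 l) := by
  have hbv : BoundedVariationOn f (Ico (t - 1) t) :=
    (hf (t - 1) t (mem_univ _) (mem_univ _)).mono fun s hs => ⟨mem_univ s, hs.1, hs.2.le⟩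
  have := hbv.exists_tendsto_left t
  rwa [inter_eq_left.2 Ico_subset_Iio_self, nhdsWithin_Ico_eq_nhdsLT (sub_one_lt t)] at this

theorem exists_tendsto_nhdsGT_of_locallyBoundedVariationOn [CompleteSpace X]
    (hf : LocallyBoundedVariationOn f univ) (t : ℝ) : ∃ l, Tendsto f (𝓝[>] t) (𝓝 l) := by
  have hbv : BoundedVariationOn f (Ioc t (t + 1)) :=
    (hf t (t + 1) (mem_univ _) (mem_univ _)).mono fun s hs => ⟨mem_univ s, hs.1.le, hs.2⟩
  have := hbv.exists_tendsto_right t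
  rwa [inter_eq_left.2 Ioc_subset_Ioi_self, nhdsWithin_Ioc_eq_nhdsGT (lt_add_one t)] at this

theorem norm_sub_le_variationOnFromTo_sub (hf : LocallyBoundedVariationOn f univ) (a : ℝ) {u v : ℝ}
    (huv : u ≤ v) :
    ‖f v - f u‖ ≤ variationOnFromTo f univ a v - variationOnFromTo f univ a u := by
  rw [← variationOnFromTo.add hf (mem_univ a) (mem_univ u) (mem_univ v), add_sub_cancel_left,
    variationOnFromTo.eq_of_le _ _ huv, ← dist_eq_norm]
  exact BoundedVariationOn.dist_le (hf u v (mem_univ u) (mem_univ v))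
    ⟨mem_univ v, huv, le_rfl⟩ ⟨mem_univ u, le_rfl, huv⟩

theorem locallyBoundedVariationOn_comp_max {a : ℝ} (hf : LocallyBoundedVariationOn f (Ici a)) :
    LocallyBoundedVariationOn (fun t => f (max t a)) univ := by
  intro u v _ _
  have hmono : Monotone fun t : ℝ => max t a := fun s t h => max_le_max_right a h
  have hmem : ∀ t, max t a ∈ Ici a := fun t => le_max_right t a
  exact ne_top_of_le_ne_top (hf _ _ (hmem u) (hmem v))
    (eVariationOn.comp_le_of_monotoneOn f _ (hmono.monotoneOn _) fun t ht =>
      ⟨hmem t, hmono ht.2.1, hmono ht.2.2⟩)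

end BoundedVariation

section ConditionD

open Function

variable {E : Type*} [NormedAddCommGroup E] [NormedSpace ℝ E] [CompleteSpace E]
  {A : ℝ → E →L[ℝ] E}

theorem exists_isRegularCoefficient_of_isUnit (hA : LocallyBoundedVariationOn A univ)
    (hleft : ∀ t, IsUnit (1 + (leftLim A t - A t)))
    (hright : ∀ t, IsUnit (1 + (rightLim A t - A t))) : ∃ W, IsRegularCoefficient A W := by
  refine ⟨fun t => variationOnFromTo A univ 0 t + t, ?_, fun {u v} huv => ?_, fun t => ?_,
    fun t => ?_⟩
  · exact (monotoneOn_univ.1 (variationOnFromTo.monotoneOn hA (mem_univ 0))).add_strictMono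
      strictMono_id
  · linarith [norm_sub_le_variationOnFromTo_sub hA 0 huv]
  · exact ⟨_, tendsto_rightLim_of_tendsto
      (exists_tendsto_nhdsGT_of_locallyBoundedVariationOn hA t), hright t⟩
  · exact ⟨_, tendsto_leftLim_of_tendsto
      (exists_tendsto_nhdsLT_of_locallyBoundedVariationOn hA t), hleft t⟩

theorem ConditionD.exists_isRegularCoefficient_comp_max (hD : ConditionD A)
    (hA : LocallyBoundedVariationOn A (Ici 0)) :
    ∃ W, IsRegularCoefficient (fun t => A (max t 0)) W := by
  have hA' := locallyBoundedVariationOn_comp_max hA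
  refine exists_isRegularCoefficient_of_isUnit hA' (fun t => ?_) fun t => ?_
  · rcases le_or_gt t 0 with ht | ht
    · have hconst : (fun _ => A 0) =ᶠ[𝓝[<] t] fun s => A (max s 0) := by
        filter_upwards [self_mem_nhdsWithin] with s hs
        rw [max_eq_right (hs.out.le.trans ht)]
      rw [leftLim_eq_of_tendsto (tendsto_const_nhds.congr' hconst), max_eq_right ht]
      simp
    · obtain ⟨B, hB⟩ := exists_tendsto_nhdsLT_of_locallyBoundedVariationOn hA' t
      have heq : (fun s => A (max s 0)) =ᶠ[𝓝[<] t] A := by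
        filter_upwards [Ioo_mem_nhdsLT ht] with s hs
        rw [max_eq_left hs.1.le]
      rw [leftLim_eq_of_tendsto hB, ← leftLim_eq_of_tendsto (hB.congr' heq), max_eq_left ht.le,
        ← neg_sub, ← sub_eq_add_neg]
      exact hD.1 t ht
  · rcases lt_or_ge t 0 with ht | ht
    · have hconst : (fun _ => A 0) =ᶠ[𝓝[>] t] fun s => A (max s 0) := by
        filter_upwards [Ioo_mem_nhdsGT ht] with s hs
        rw [max_eq_right hs.2.le]
      rw [rightLim_eq_of_tendsto (tendsto_const_nhds.congr' hconst), max_eq_right ht.le]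
      simp
    · obtain ⟨B, hB⟩ := exists_tendsto_nhdsGT_of_locallyBoundedVariationOn hA' t
      have heq : (fun s => A (max s 0)) =ᶠ[𝓝[>] t] A := by
        filter_upwards [self_mem_nhdsWithin] with s hs
        rw [max_eq_left (ht.trans hs.out.le)]
      rw [rightLim_eq_of_tendsto hB, ← rightLim_eq_of_tendsto (hB.congr' heq), max_eq_left ht]
      exact hD.2 t ht

end ConditionD

section TransitionMatrix

variable {E : Type*} [NormedAddCommGroup E] [NormedSpace ℝ E] {A : ℝ → E →L[ℝ] E} {W : ℝ → ℝ}
  {U V : ℝ → ℝ → E →L[ℝ] E} {s t : ℝ}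

/-- The coefficient of the operator equation `dY/dτ = D[A(t)Y]`, regarded as a generalized linear
differential equation in the Banach space of operators on `E`. -/
noncomputable def operatorCoefficient (A : ℝ → E →L[ℝ] E) :
    ℝ → (E →L[ℝ] E) →L[ℝ] (E →L[ℝ] E) :=
  fun t => ContinuousLinearMap.mul ℝ (E →L[ℝ] E) (A t)

theorem isUnit_continuousLinearMapMul {R : Type*} [NormedRing R] [NormedAlgebra ℝ R] {r : R}
    (hr : IsUnit r) : IsUnit (ContinuousLinearMap.mul ℝ R r) := by
  obtain ⟨q, hrq, hqr⟩ := isUnit_iff_exists.1 hr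
  refine isUnit_iff_exists.2 ⟨ContinuousLinearMap.mul ℝ R q, ?_, ?_⟩
  · ext y
    simp [← mul_assoc, hrq]
  · ext y
    simp [← mul_assoc, hqr]

theorem isRegularCoefficient_operatorCoefficient (hA : IsRegularCoefficient A W) :
    IsRegularCoefficient (operatorCoefficient A) W := by
  have hlim : ∀ {l t}, (∃ B, Tendsto A l (𝓝 B) ∧ IsUnit (1 + (B - A t))) →
      ∃ B, Tendsto (operatorCoefficient A) l (𝓝 B) ∧
        IsUnit (1 + (B - operatorCoefficient A t)) := by
    rintro l t ⟨B, hB, hunit⟩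
    refine ⟨_, ((ContinuousLinearMap.mul ℝ (E →L[ℝ] E)).continuous.tendsto B).comp hB, ?_⟩
    have hone : ContinuousLinearMap.mul ℝ (E →L[ℝ] E) 1 = 1 := by
      ext1 Y
      simp
    rw [← hone, operatorCoefficient, ← map_sub, ← map_add]
    exact isUnit_continuousLinearMapMul hunit
  refine ⟨hA.strictMono, fun {u v} huv => ?_, fun t => hlim (hA.right t), fun t => hlim (hA.left t)⟩
  rw [operatorCoefficient, operatorCoefficient, ← map_sub]
  exact (ContinuousLinearMap.opNorm_mul_apply_le ℝ _ _).trans (hA.norm_sub_le huv)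

theorem IsGLDESolution.apply {J : Set ℝ} {Y : ℝ → E →L[ℝ] E}
    (hY : IsGLDESolution (operatorCoefficient A) J Y) (e : E) :
    IsGLDESolution A J fun t => Y t e :=
  fun c d hcd hJ => (hY c d hcd hJ).map (ContinuousLinearMap.apply ℝ E e)

theorem IsGLDESolution.eqOn_of_subset_Ici (hA : IsRegularCoefficient (fun t => A (max t 0)) W)
    {J : Set ℝ} [hJc : J.OrdConnected] (hJ : J ⊆ Ici 0) {x y : ℝ → E} (hx : IsGLDESolution A J x)
    (hy : IsGLDESolution A J y) (hs : s ∈ J) (hxy : x s = y s) : EqOn x y J := by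
  intro t ht
  have hsub : uIcc s t ⊆ J := hJc.uIcc_subset hs ht
  have hmax : EqOn A (fun t => A (max t 0)) (uIcc s t) := fun r hr => by
    simp only [max_eq_left (hJ (hsub hr)).out]
  exact ((hx.mono hsub).congr hmax (eqOn_refl _ _)).eqOn_of_eq hA
    ((hy.mono hsub).congr hmax (eqOn_refl _ _)) left_mem_uIcc hxy right_mem_uIcc

theorem exists_isTransitionMatrix [CompleteSpace E]
    (hA : IsRegularCoefficient (fun t => A (max t 0)) W) : ∃ U, IsTransitionMatrix A U := by
  choose Y hY hYs using fun s =>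
    (isRegularCoefficient_operatorCoefficient hA).exists_isGLDESolution s 1
  have hsol : ∀ s, IsGLDESolution (operatorCoefficient A) (Ici 0) (Y s) := fun s =>
    ((hY s).mono (subset_univ _)).congr
      (fun t ht => by simp only [operatorCoefficient, max_eq_left ht.out]) (eqOn_refl _ _)
  refine ⟨fun t s => Y s t, fun t s ht hs => ⟨fun hst => ?_, fun hts => ?_⟩⟩
  · have h := hsol s s t hst (Icc_subset_Ici_self.trans (Ici_subset_Ici.2 hs))
    rwa [hYs] at h
  · have h := hsol s t s hts.le (Icc_subset_Ici_self.trans (Ici_subset_Ici.2 ht))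
    rwa [hYs, ← neg_sub] at h

namespace IsTransitionMatrix

theorem self_eq_one (hU : IsTransitionMatrix A U) (hs : 0 ≤ s) : U s s = 1 :=
  sub_eq_zero.1 ((hU s s hs hs).1 le_rfl).self_eq_zero

theorem isGLDESolution_Ici (hU : IsTransitionMatrix A U) (hs : 0 ≤ s) :
    IsGLDESolution (operatorCoefficient A) (Ici s) fun t => U t s := by
  intro c d hcd hJ
  have hsc : s ≤ c := hJ (left_mem_Icc.2 hcd)
  have hsd := hsc.trans hcd
  have h := ((hU d s (hs.trans hsd) hs).1 hsd).sub_left ((hU c s (hs.trans hsc) hs).1 hsc) hsc hcd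
  rwa [sub_sub_sub_cancel_right] at h

theorem hasKurzweilIntegral (hU : IsTransitionMatrix A U) (ht : 0 ≤ t) (hts : t ≤ s) :
    HasKurzweilIntegral (fun τ r => A r * U τ s) t s (1 - U t s) := by
  rcases hts.eq_or_lt with rfl | hlt
  · rw [hU.self_eq_one ht, sub_self]
    exact hasKurzweilIntegral_self
  · rw [← neg_sub]
    exact (hU t s ht (ht.trans hts)).2 hlt

theorem isGLDESolution_Icc (hU : IsTransitionMatrix A U) (ht : 0 ≤ t) :
    IsGLDESolution (operatorCoefficient A) (Icc t s) fun r => U r s := by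
  intro c d hcd hJ
  have hc := hJ (left_mem_Icc.2 hcd)
  have hd := hJ (right_mem_Icc.2 hcd)
  have h := (hU.hasKurzweilIntegral (ht.trans hc.1) hc.2).sub_right
    (hU.hasKurzweilIntegral (ht.trans hd.1) hd.2) hcd hd.2
  rwa [sub_sub_sub_cancel_left] at h

theorem eq (hU : IsTransitionMatrix A U) (hV : IsTransitionMatrix A V)
    (hA : IsRegularCoefficient (fun t => A (max t 0)) W) (ht : 0 ≤ t) (hs : 0 ≤ s) :
    U t s = V t s := by
  have hA' := isRegularCoefficient_operatorCoefficient hA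
  have hself : U s s = V s s := by rw [hU.self_eq_one hs, hV.self_eq_one hs]
  rcases le_total s t with hst | hts
  · exact IsGLDESolution.eqOn_of_subset_Ici hA' (Ici_subset_Ici.2 hs)
      (hU.isGLDESolution_Ici hs) (hV.isGLDESolution_Ici hs) self_mem_Ici hself hst
  · exact IsGLDESolution.eqOn_of_subset_Ici hA'
      (Icc_subset_Ici_self.trans (Ici_subset_Ici.2 ht))
      (hU.isGLDESolution_Icc ht) (hV.isGLDESolution_Icc ht) (right_mem_Icc.2 hts) hself
      (left_mem_Icc.2 hts)

theorem isGLDESolution (hU : IsTransitionMatrix A U) (hs : 0 ≤ s) (e : E) :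
    IsGLDESolution A (Ici s) fun t => U t s e :=
  (hU.isGLDESolution_Ici hs).apply e

theorem solution_eq (hU : IsTransitionMatrix A U)
    (hA : IsRegularCoefficient (fun t => A (max t 0)) W) (hs : 0 ≤ s) {x : ℝ → E}
    (hx : IsGLDESolution A (Ici s) x) (hst : s ≤ t) : x t = U t s (x s) :=
  hx.eqOn_of_subset_Ici hA (Ici_subset_Ici.2 hs) (hU.isGLDESolution hs (x s)) self_mem_Ici
    (by simp [hU.self_eq_one hs]) hst

theorem mul_eq (hU : IsTransitionMatrix A U)
    (hA : IsRegularCoefficient (fun t => A (max t 0)) W) {r : ℝ} (hs : 0 ≤ s) (hsr : s ≤ r)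
    (hrt : r ≤ t) : U t s = U t r * U r s := by
  ext e
  exact hU.solution_eq hA (hs.trans hsr)
    ((hU.isGLDESolution hs e).mono (Ici_subset_Ici.2 hsr)) hrt

end IsTransitionMatrix

end TransitionMatrix

section Stability

open Real

theorem opNorm_le_of_forall_norm_lt {E F : Type*} [NormedAddCommGroup E] [NormedSpace ℝ E]
    [NormedAddCommGroup F] [NormedSpace ℝ F] {L : E →L[ℝ] F} {δ C : ℝ} (hδ : 0 < δ)
    (hL : ∀ e, ‖e‖ < δ → ‖L e‖ ≤ C) : ‖L‖ ≤ 2 * C / δ := by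
  have hC : 0 ≤ C := by simpa using hL 0 (by simpa using hδ)
  refine ContinuousLinearMap.opNorm_le_of_shell (c := (2 : ℝ)) hδ (by positivity) (by simp)
    fun e he heδ => (hL e heδ).trans ?_
  rw [norm_ofNat] at he
  calc C = 2 * C / δ * (δ / 2) := by field_simp
    _ ≤ 2 * C / δ * ‖e‖ := by gcongr

theorem exists_exp_bound_of_le_half_shift {φ : ℝ → ℝ → ℝ} {M T : ℝ} (hM : 0 < M) (hT : 0 < T)
    (hbound : ∀ t s, 0 ≤ s → s ≤ t → φ t s ≤ M)
    (hhalf : ∀ t s, 0 ≤ s → s + T ≤ t → φ t s ≤ φ t (s + T) / 2) :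
    ∃ α > 0, ∃ K > 0, ∀ t s, 0 ≤ s → s ≤ t → φ t s ≤ K * exp (-α * (t - s)) := by
  set α := log 2 / T
  have hα : 0 < α := div_pos (log_pos one_lt_two) hT
  have hαT : exp (α * T) = 2 := by rw [div_mul_cancel₀ _ hT.ne', exp_log two_pos]
  have hstep : ∀ t s, 2 * exp (-α * (t - s)) = exp (-α * (t - (s + T))) := fun t s => by
    rw [← hαT, ← exp_add]
    ring_nf
  have hshort : ∀ t s, 0 ≤ s → s ≤ t → t ≤ s + T → φ t s ≤ 2 * M * exp (-α * (t - s)) :=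
    fun t s hs hst hts => by
      have hexp : 1 ≤ exp (-α * (t - (s + T))) := one_le_exp (by nlinarith)
      calc φ t s ≤ M * 1 := by simpa using hbound t s hs hst
        _ ≤ M * exp (-α * (t - (s + T))) := by gcongr
        _ = 2 * M * exp (-α * (t - s)) := by rw [← hstep]; ring
  have hdecay : ∀ (n : ℕ) (t s : ℝ), 0 ≤ s → s ≤ t → t ≤ s + n * T →
      φ t s ≤ 2 * M * exp (-α * (t - s)) := by
    intro n
    induction n with
    | zero => exact fun t s hs hst htn => hshort t s hs hst (by norm_num at htn; linarith)
    | succ n ih =>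
      intro t s hs hst htn
      rcases le_total t (s + T) with h | h
      · exact hshort t s hs hst h
      · calc φ t s ≤ φ t (s + T) / 2 := hhalf t s hs h
          _ ≤ 2 * M * exp (-α * (t - (s + T))) / 2 := by
            gcongr
            exact ih t (s + T) (by linarith) h (by push_cast at htn; linarith)
          _ = 2 * M * exp (-α * (t - s)) := by rw [← hstep]; ring
  refine ⟨α, hα, 2 * M, by positivity, fun t s hs hst => ?_⟩
  obtain ⟨n, hn⟩ := exists_nat_ge ((t - s) / T)
  exact hdecay n t s hs hst (by linarith [(div_le_iff₀ hT).1 hn])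

variable {E : Type*} [NormedAddCommGroup E] [NormedSpace ℝ E] {A : ℝ → E →L[ℝ] E} {W : ℝ → ℝ}
  {U : ℝ → ℝ → E →L[ℝ] E}

theorem IsTransitionMatrix.opNorm_le_of_forall_solution (hU : IsTransitionMatrix A U)
    {s t δ C : ℝ} (hs : 0 ≤ s) (hδ : 0 < δ)
    (h : ∀ x, IsGLDESolution A (Ici s) x → ‖x s‖ < δ → ‖x t‖ ≤ C) : ‖U t s‖ ≤ 2 * C / δ :=
  opNorm_le_of_forall_norm_lt hδ fun e he =>
    h _ (hU.isGLDESolution hs e) (by simpa [hU.self_eq_one hs] using he)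

theorem UniformlyAsymptoticallyStable.exists_exp_bound (h : UniformlyAsymptoticallyStable A)
    (hA : IsRegularCoefficient (fun t => A (max t 0)) W) (hU : IsTransitionMatrix A U) :
    ∃ α > 0, ∃ K > 0, ∀ t s : ℝ, 0 ≤ s → s ≤ t → ‖U t s‖ ≤ K * exp (-α * (t - s)) := by
  obtain ⟨hstable, δ₀, hδ₀, hattractive⟩ := h
  obtain ⟨δ, hδ, hstable⟩ := hstable 1 one_pos
  obtain ⟨T, hT, hattractive⟩ := hattractive (δ₀ / 4) (by positivity)
  have hT' : 0 < T + 1 := by linarith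
  have hbound : ∀ t s, 0 ≤ s → s ≤ t → ‖U t s‖ ≤ 2 * 1 / δ := fun t s hs hst =>
    hU.opNorm_le_of_forall_solution hs hδ fun x hx hxs => (hstable s hs x hx hxs t hst).le
  have hcontract : ∀ s, 0 ≤ s → ‖U (s + (T + 1)) s‖ ≤ 1 / 2 := fun s hs =>
    calc ‖U (s + (T + 1)) s‖ ≤ 2 * (δ₀ / 4) / δ₀ :=
          hU.opNorm_le_of_forall_solution hs hδ₀ fun x hx hxs =>
            (hattractive s hs x hx hxs _ (by linarith)).le
      _ = 1 / 2 := by field_simp; norm_num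
  refine exists_exp_bound_of_le_half_shift (φ := fun t s => ‖U t s‖) (by positivity) hT' hbound
    fun t s hs hst => ?_
  calc ‖U t s‖ = ‖U t (s + (T + 1)) * U (s + (T + 1)) s‖ := by
        rw [← hU.mul_eq hA hs (by linarith) hst]
    _ ≤ ‖U t (s + (T + 1))‖ * ‖U (s + (T + 1)) s‖ := norm_mul_le _ _
    _ ≤ ‖U t (s + (T + 1))‖ * (1 / 2) := by gcongr; exact hcontract s hs
    _ = ‖U t (s + (T + 1))‖ / 2 := by ring

theorem IsTransitionMatrix.globallyUniformlyExponentiallyStable (hU : IsTransitionMatrix A U)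
    (hA : IsRegularCoefficient (fun t => A (max t 0)) W)
    (h : ∃ α > 0, ∃ K > 0, ∀ t s : ℝ, 0 ≤ s → s ≤ t → ‖U t s‖ ≤ K * exp (-α * (t - s))) :
    GloballyUniformlyExponentiallyStable A := by
  obtain ⟨α, hα, K, hK, h⟩ := h
  refine ⟨α, hα, K + 1, by positivity, fun s hs x hx hxs t hst => ?_⟩
  have : 0 < ‖x s‖ := norm_pos_iff.2 hxs
  rw [hU.solution_eq hA hs hx hst]
  calc ‖U t s (x s)‖ ≤ K * exp (-α * (t - s)) * ‖x s‖ := (U t s).le_of_opNorm_le (h t s hs hst) _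
    _ = K * ‖x s‖ * exp (-α * (t - s)) := by ring
    _ < (K + 1) * ‖x s‖ * exp (-α * (t - s)) := by gcongr; linarith

theorem isGLDESolution_zero (J : Set ℝ) : IsGLDESolution A J 0 := fun c d _ _ ε hε =>
  ⟨fun _ => 1, fun _ _ => one_pos, fun P _ => by simpa [KurzweilPartition.riemannSum]⟩

theorem GloballyUniformlyExponentiallyStable.exists_norm_le
    (h : GloballyUniformlyExponentiallyStable A)
    (hA : IsRegularCoefficient (fun t => A (max t 0)) W) :
    ∃ α > 0, ∃ K > 0, ∀ s : ℝ, 0 ≤ s → ∀ x : ℝ → E, IsGLDESolution A (Ici s) x → ∀ t, s ≤ t →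
      ‖x t‖ ≤ K * ‖x s‖ * exp (-α * (t - s)) := by
  obtain ⟨α, hα, K, hK, h⟩ := h
  refine ⟨α, hα, K, hK, fun s hs x hx t hst => ?_⟩
  by_cases hxs : x s = 0
  · have hzero := hx.eqOn_of_subset_Ici hA (Ici_subset_Ici.2 hs) (isGLDESolution_zero _)
      self_mem_Ici hxs hst
    simp [hzero, hxs]
  · exact (h s hs x hx hxs t hst).le

theorem GloballyUniformlyExponentiallyStable.uniformlyAsymptoticallyStable
    (h : GloballyUniformlyExponentiallyStable A)
    (hA : IsRegularCoefficient (fun t => A (max t 0)) W) : UniformlyAsymptoticallyStable A := by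
  obtain ⟨α, hα, K, hK, h⟩ := h.exists_norm_le hA
  have hdecay : Tendsto (fun r => K * exp (-α * r)) atTop (𝓝 0) := by
    simpa using (tendsto_exp_atBot.comp
      (tendsto_id.const_mul_atTop_of_neg (neg_lt_zero.2 hα))).const_mul K
  refine ⟨fun ε hε => ⟨ε / K, by positivity, fun s hs x hx hxs t hst => ?_⟩, 1, one_pos,
    fun ε hε => ?_⟩
  · have hexp : exp (-α * (t - s)) ≤ 1 := exp_le_one_iff.2 (by nlinarith)
    calc ‖x t‖ ≤ K * ‖x s‖ * exp (-α * (t - s)) := h s hs x hx t hst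
      _ ≤ K * ‖x s‖ * 1 := by gcongr
      _ = ‖x s‖ * K := by ring
      _ < ε := (lt_div_iff₀ hK).1 hxs
  · obtain ⟨T, hT⟩ := eventually_atTop.1 (hdecay.eventually_lt_const hε)
    refine ⟨max 0 T, le_max_left _ _, fun s hs x hx hxs t hst => ?_⟩
    have hsT : 0 ≤ t - s ∧ T ≤ t - s := max_le_iff.1 (by linarith)
    calc ‖x t‖ ≤ K * ‖x s‖ * exp (-α * (t - s)) := h s hs x hx t (by linarith [hsT.1])
      _ ≤ K * 1 * exp (-α * (t - s)) := by gcongr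
      _ = K * exp (-α * (t - s)) := by rw [mul_one]
      _ < ε := hT _ hsT.2

end Stability

theorem theorem3p4_general {E : Type*} [NormedAddCommGroup E] [NormedSpace ℝ E] [CompleteSpace E]
    (A : ℝ → E →L[ℝ] E) (hA : LocallyBoundedVariationOn A (Set.Ici 0)) (hD : ConditionD A) :
    ∃ U : ℝ → ℝ → E →L[ℝ] E,
      IsTransitionMatrix A U ∧
      (∀ V : ℝ → ℝ → E →L[ℝ] E, IsTransitionMatrix A V →
        ∀ t s : ℝ, 0 ≤ t → 0 ≤ s → V t s = U t s) ∧
      (UniformlyAsymptoticallyStable A ↔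
        ∃ α > 0, ∃ K > 0, ∀ t s : ℝ, 0 ≤ s → s ≤ t →
          ‖U t s‖ ≤ K * Real.exp (-α * (t - s))) ∧
      (UniformlyAsymptoticallyStable A ↔ GloballyUniformlyExponentiallyStable A) := by
  obtain ⟨W, hW⟩ := hD.exists_isRegularCoefficient_comp_max hA
  obtain ⟨U, hU⟩ := exists_isTransitionMatrix hW
  refine ⟨U, hU, fun V hV t s => hV.eq hU hW, ⟨fun h => h.exists_exp_bound hW hU, fun h => ?_⟩,
    fun h => ?_, fun h => h.uniformlyAsymptoticallyStable hW⟩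
  · exact (hU.globallyUniformlyExponentiallyStable hW h).uniformlyAsymptoticallyStable hW
  · exact hU.globallyUniformlyExponentiallyStable hW (h.exists_exp_bound hW hU)

theorem theorem3p4 {E : Type*} [NormedAddCommGroup E] [NormedSpace ℝ E] [FiniteDimensional ℝ E]
    (A : ℝ → E →L[ℝ] E) (hA : LocallyBoundedVariationOn A (Set.Ici 0)) (hD : ConditionD A) :
    ∃ U : ℝ → ℝ → E →L[ℝ] E,
      -- `U` is the transition matrix, and it is uniquely determined on `[0,∞) × [0,∞)`
      IsTransitionMatrix A U ∧
      (∀ V : ℝ → ℝ → E →L[ℝ] E, IsTransitionMatrix A V →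
        ∀ t s : ℝ, 0 ≤ t → 0 ≤ s → V t s = U t s) ∧
      (UniformlyAsymptoticallyStable A ↔
        ∃ α > 0, ∃ K > 0, ∀ t s : ℝ, 0 ≤ s → s ≤ t →
          ‖U t s‖ ≤ K * Real.exp (-α * (t - s))) ∧
      (UniformlyAsymptoticallyStable A ↔ GloballyUniformlyExponentiallyStable A) := by
  have := FiniteDimensional.complete ℝ E
  exact theorem3p4_general A hA hD
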